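/- **Setting.** Let $T$ be a finite tree with $n\ge 1$ nodes, rooted at a node $\mathrm{root}$. Let $\delta(v)$ be the distance of $v$ to the root, $D=\max_v\delta(v)$ the depth, and $\Delta$ the maximum degree. A team of $k\ge 1$ robots starts at the root and moves in synchronous rounds; robots share all information. At each moment a node is *discovered* if some robot has occupied it, an edge is *explored* if some robot has traversed it, and an edge is *dangling* if it has a discovered endpoint and is not explored. **Breadth-First Depth-Next (BFDN).** Every robot $i$ has an anchor $v_i$ (initially the root) and a stack $S_i$ of edges (initially empty). In each round, robots $i=1,\dots,k$ take the following steps, one after the other. 1. If robot $i$ is at the root, it receives a new anchor. Let $A$ be the set of discovered nodes that are adjacent to a dangling edge and have minimal depth among such nodes. If $A\neq\emptyset$, then $v_i$ becomes a node of $A$ that minimizes the current number $\#\{j : v_j=v\}$ of robots anchored at $v\in A$; otherwise $v_i$ becomes the root. The edges of the path from the root to $v_i$ are put on $S_i$, the first edge on top. 2. If $S_i$ is not empty, robot $i$ removes the top edge of $S_i$ and selects it. Otherwise, robot $i$ selects a dangling edge adjacent to its position that no robot has selected so far in this round; if there is none, it selects the edge towards the root, or no move if it is at the root. Then all robots move simultaneously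 along their selected edges, and the sets of discovered nodes and explored edges are updated. Rounds are repeated until a round occurs in which no robot would change position. The remaining choices (ties between anchors, which dangling edge is selected) are arbitrary. The running time $R$ is the number of rounds before termination, that is, before the first moment at which there is no dangling edge and all robots are at the root; the final idle round that detects termination is not counted. **Theorem.** For every such tree, every $k\ge 1$ and every resolution of the arbitrary choices, BFDN terminates. Some robot changes position in each of the first $R$ rounds, and no robot does in the next one. After $R$ rounds all nodes have been visited, all edges have been traversed, and all robots are at the root. Moreover $$R\;\le\;\frac{2n}{k}+D^2\bigl(\min\{\log\Delta,\log k\}+2\bigr),$$ where $\log$ is the natural logarithm (for $n=1$ the second term is $0$, since $D=0$). -/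

import Mathlib

namespace BFDN

/-- Everything that evolves from round to round: the position, the anchor and the stack of each
robot, the discovered nodes (those already occupied by some robot) and the explored edges (those
already traversed by some robot). Edges are unordered pairs of nodes. -/
structure State (V : Type*) (k : ℕ) where
  pos : Fin k → V
  anchor : Fin k → V
  stack : Fin k → List (Sym2 V)
  discovered : Set V
  explored : Set (Sym2 V)

/-- What the robots update, one after the other, inside a round: anchors, stacks, and the edges
selected so far. `none` means that the robot will not move (or has not selected yet). -/
structure Memory (V : Type*) (k : ℕ) where
  anchor : Fin k → V
  stack : Fin k → List (Sym2 V)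
  selected : Fin k → Option (Sym2 V)

section
variable {V : Type*} {k : ℕ}

/-- All robots and all anchors are at the root, all stacks are empty, nothing is explored. -/
def State.init (root : V) : State V k where
  pos := fun _ => root
  anchor := fun _ => root
  stack := fun _ => []
  discovered := {root}
  explored := ∅

/-- The edges with a discovered endpoint that no robot has traversed. -/
def State.dangling (T : SimpleGraph V) (s : State V k) : Set (Sym2 V) :=
  {e | e ∈ T.edgeSet ∧ (∃ u ∈ e, u ∈ s.discovered) ∧ e ∉ s.explored}

/-- The discovered nodes that are adjacent to a dangling edge. -/
def State.openNodes (T : SimpleGraph V) (s : State V k) : Set V :=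
  {v | v ∈ s.discovered ∧ ∃ e ∈ s.dangling T, v ∈ e}

/-- The open nodes of minimal depth. -/
def State.candidates (T : SimpleGraph V) (root : V) (s : State V k) : Set V :=
  {v | v ∈ s.openNodes T ∧ ∀ u ∈ s.openNodes T, T.dist root v ≤ T.dist root u}

/-- The number of robots currently anchored at `v`. -/
def Memory.load [DecidableEq V] (m : Memory V k) (v : V) : ℕ :=
  (Finset.univ.filter fun j => m.anchor j = v).card

/-- `a` is a possible outcome of `Reanchor`: a candidate with the least number of anchored robots
if there is a candidate, the root otherwise. -/
def Reanchor [DecidableEq V] (T : SimpleGraph V) (root : V) (s : State V k) (m : Memory V k)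
    (a : V) : Prop :=
  (a ∈ s.candidates T root ∧ ∀ b ∈ s.candidates T root, m.load a ≤ m.load b) ∨
    (s.candidates T root = ∅ ∧ a = root)

/-- `m'` results from `m` when robot `i`, if it is at the root, gets a new anchor and stacks the
edges of the path from the root to that anchor, the first edge on top. -/
def AnchorStep [DecidableEq V] (T : SimpleGraph V) (root : V) (s : State V k) (i : Fin k)
    (m m' : Memory V k) : Prop :=
  (s.pos i = root ∧ ∃ (a : V) (p : T.Walk root a), Reanchor T root s m a ∧ p.IsPath ∧
      m' = { m with
        anchor := Function.update m.anchor i a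
        stack := Function.update m.stack i p.edges }) ∨
    (s.pos i ≠ root ∧ m' = m)

/-- `o` is the direction `up` at node `u`: the edge towards the root, or no move at the root. -/
def IsUp (T : SimpleGraph V) (root u : V) (o : Option (Sym2 V)) : Prop :=
  (u = root ∧ o = none) ∨
    (u ≠ root ∧ ∃ w, T.Adj u w ∧ T.dist root u = T.dist root w + 1 ∧ o = some s(u, w))

/-- Robot `i` unstacks an edge and selects it. -/
def BreadthFirst (i : Fin k) (m m' : Memory V k) : Prop :=
  ∃ e l, m.stack i = e :: l ∧
    m' = { m with
      stack := Function.update m.stack i l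
      selected := Function.update m.selected i (some e) }

/-- The dangling edges at the position of robot `i` that no robot has selected so far. -/
def available (T : SimpleGraph V) (s : State V k) (i : Fin k) (m : Memory V k) : Set (Sym2 V) :=
  {e | e ∈ s.dangling T ∧ s.pos i ∈ e ∧ ∀ j, m.selected j ≠ some e}

/-- Robot `i` selects an available dangling edge if there is one and `up` otherwise. -/
def DepthNext (T : SimpleGraph V) (root : V) (s : State V k) (i : Fin k)
    (m m' : Memory V k) : Prop :=
  ∃ o, ((∃ e ∈ available T s i m, o = some e) ∨
        (available T s i m = ∅ ∧ IsUp T root (s.pos i) o)) ∧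
    m' = { m with selected := Function.update m.selected i o }

/-- The turn of robot `i` in the `for` loop of a round that starts in state `s`. -/
def Turn [DecidableEq V] (T : SimpleGraph V) (root : V) (s : State V k) (i : Fin k)
    (m m' : Memory V k) : Prop :=
  ∃ m₁, AnchorStep T root s i m m₁ ∧
    ((m₁.stack i ≠ [] ∧ BreadthFirst i m₁ m') ∨
      (m₁.stack i = [] ∧ DepthNext T root s i m₁ m'))

open Classical in
/-- The node reached from `u` along the selected edge. -/
noncomputable def target (u : V) : Option (Sym2 V) → V
  | none => u
  | some e => if h : u ∈ e then Sym2.Mem.other h else u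

/-- The synchronous move along the selected edges, and the update of the explored tree. -/
noncomputable def State.move (s : State V k) (m : Memory V k) : State V k where
  pos := fun i => target (s.pos i) (m.selected i)
  anchor := m.anchor
  stack := m.stack
  discovered := s.discovered ∪ {v | ∃ i, v = target (s.pos i) (m.selected i)}
  explored := s.explored ∪ {e | ∃ i, m.selected i = some e}

/-- One round: robots `1, …, k` take their turns in this order, then all move in parallel. The
choices that the algorithm leaves open (ties between anchors, which dangling edge to select) make
this a relation. -/
def Round [DecidableEq V] (T : SimpleGraph V) (root : V) (s s' : State V k) : Prop :=
  ∃ m : Fin (k + 1) → Memory V k,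
    m 0 = { anchor := s.anchor, stack := s.stack, selected := fun _ => none } ∧
    (∀ i : Fin k, Turn T root s i (m i.castSucc) (m i.succ)) ∧
    s' = s.move (m (Fin.last k))

/-- `s t` is the state after `t` rounds, for some way to resolve the choices of the algorithm. -/
def IsRun [DecidableEq V] (T : SimpleGraph V) (root : V) (s : ℕ → State V k) : Prop :=
  s 0 = State.init root ∧ ∀ t, Round T root (s t) (s (t + 1))

/-- The run exits the loop `do … while some robot changes position` after exactly `R` rounds in
which some robot changes position. -/
def StopsAfter (s : ℕ → State V k) (R : ℕ) : Prop :=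
  (∀ t < R, (s (t + 1)).pos ≠ (s t).pos) ∧ (s (R + 1)).pos = (s R).pos

/-- There is no dangling edge, every node has been visited, every edge has been traversed, and all
robots are at the root. -/
def ExploredAndReturned (T : SimpleGraph V) (root : V) (s : State V k) : Prop :=
  s.dangling T = ∅ ∧ s.discovered = Set.univ ∧ s.explored = T.edgeSet ∧ ∀ i, s.pos i = root

/-- The depth of the tree: the largest distance of a node to the root. -/
noncomputable def depth [Fintype V] (T : SimpleGraph V) (root : V) : ℕ :=
  Finset.univ.sup fun v => T.dist root v

end

end BFDN

/-!
Count the moves of the robots. A robot moves down along its stack, down through a dangling edge, or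
back up, or it pauses at the root. As it ends at the root, it moves up as often as down. Dangling
edges are traversed at most `n - 1` times in all (`TracedRun.card_discoveries_lt`), the moves along
stacks are paid for by the depths of the assigned anchors (`TracedRun.remaining_succ`), and before
the exploration ends robots pause only in a single round (`TracedRun.card_pauses_le`). So the
theorem comes down to a bound on the number of times that an anchor of depth `d` is assigned, for
`1 ≤ d < D`; it is at most `k * (min (log Δ) (log k) + 2)`
(`TracedRun.card_assignments_le_min`).

A robot anchored at an open node of minimal depth `d` does not return to the root before the node is
closed. Hence the load of a candidate only grows, and no candidate is ever added while anchors of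
depth `d` are assigned. Moreover each candidate has a guard below it, for instance the robot that
discovered it, whose anchor is less deep (`Inv.guard`). If the least load of the candidates is `j`,
there are therefore at most `k / (j + 1)` of them (`TracedRun.card_candidates_mul_le`). As each of
them is assigned at most once at load `j`, there are at most `k / (j + 1)` assignments at load `j`
(`TracedRun.card_filter_loadBefore_eq_mul_le`), and summing over `j < c` gives `k * (log c + 1)`.

For `c = k` these are all assignments. For `c = Δ` there may be others, but at most one for each
robot: the robot is away for more than `d` rounds, during which all robots anchored at the remaining
candidates reach them, and each leaves through a dangling edge of its own
(`TracedRun.loadBefore_lt_maxDegree`).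

After the exploration every robot is back within `2 * D - 1` rounds. The anchors of depths
`1, …, D - 1` cost at most `D * (D - 1) * (log + 2)` rounds, and the gap to `D ^ 2 * (log + 2)`
covers these `2 * D - 1` rounds and the round of the pauses.
-/

namespace BFDN

/-! ### Rooted trees -/

section Tree
variable {V : Type*} {T : SimpleGraph V} {root : V}

open Classical in
/-- The parent of a node: a neighbour that is closer to the root. The root is its own parent. -/
noncomputable def par (T : SimpleGraph V) (root v : V) : V :=
  if h : ∃ w, T.Adj v w ∧ T.dist root v = T.dist root w + 1 then h.choose else v

lemma exists_closer (hT : T.IsTree) {v : V} (hv : v ≠ root) :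
    ∃ w, T.Adj v w ∧ T.dist root v = T.dist root w + 1 := by
  obtain ⟨p, hp⟩ := hT.connected.exists_walk_length_eq_dist v root
  cases p with
  | nil => exact absurd rfl hv
  | @cons _ w _ h q =>
    refine ⟨w, h, ?_⟩
    have h1 := SimpleGraph.dist_le q
    rw [SimpleGraph.dist_comm] at h1 hp
    simp only [SimpleGraph.Walk.length_cons] at hp
    have := hT.dist_eq_dist_add_one_of_adj root h
    lia

lemma adj_par (hT : T.IsTree) {v : V} (hv : v ≠ root) : T.Adj v (par T root v) := by
  rw [par, dif_pos (exists_closer hT hv)]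
  exact (exists_closer hT hv).choose_spec.1

lemma dist_par (hT : T.IsTree) {v : V} (hv : v ≠ root) :
    T.dist root v = T.dist root (par T root v) + 1 := by
  rw [par, dif_pos (exists_closer hT hv)]
  exact (exists_closer hT hv).choose_spec.2

@[simp] lemma par_root : par T root root = root := by
  rw [par, dif_neg]
  simp

lemma dist_eq_zero_iff_root (hT : T.IsTree) {v : V} : T.dist root v = 0 ↔ v = root := by
  rw [hT.connected.dist_eq_zero_iff, eq_comm]

/-- Two closer neighbours of `v` would yield two paths from the root to `v`. -/
lemma eq_of_closer (hT : T.IsTree) {v w w' : V} (h : T.Adj v w)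
    (hd : T.dist root v = T.dist root w + 1) (h' : T.Adj v w')
    (hd' : T.dist root v = T.dist root w' + 1) : w = w' := by
  obtain ⟨p, -, hp⟩ := hT.connected.exists_path_of_dist root w
  obtain ⟨p', -, hp'⟩ := hT.connected.exists_path_of_dist root w'
  have hq : (p.concat h.symm).IsPath := SimpleGraph.Walk.isPath_of_length_eq_dist _ (by simp; lia)
  have hq' : (p'.concat h'.symm).IsPath :=
    SimpleGraph.Walk.isPath_of_length_eq_dist _ (by simp; lia)
  have := congrArg (fun r : T.Path root v => r.1.penultimate)
    ((hT.isAcyclic.subsingleton_path root v).elim ⟨_, hq⟩ ⟨_, hq'⟩)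
  simpa using this

lemma eq_par (hT : T.IsTree) {v w : V} (h : T.Adj v w)
    (hd : T.dist root v = T.dist root w + 1) : w = par T root v := by
  have hv : v ≠ root := by rintro rfl; simp at hd
  exact eq_of_closer hT h hd (adj_par hT hv) (dist_par hT hv)

lemma par_or_par_of_adj (hT : T.IsTree) {u w : V} (h : T.Adj u w) :
    (u ≠ root ∧ par T root u = w) ∨ (w ≠ root ∧ par T root w = u) := by
  rcases hT.dist_eq_dist_add_one_of_adj root h with hd | hd
  · exact .inl ⟨by rintro rfl; simp at hd, (eq_par hT h hd).symm⟩
  · exact .inr ⟨by rintro rfl; simp at hd, (eq_par hT h.symm hd).symm⟩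

/-- `w` is a child of `u`. -/
def IsChild (T : SimpleGraph V) (root u w : V) : Prop := w ≠ root ∧ par T root w = u

lemma IsChild.adj (hT : T.IsTree) {u w : V} (h : IsChild T root u w) : T.Adj u w :=
  h.2 ▸ (adj_par hT h.1).symm

lemma IsChild.dist (hT : T.IsTree) {u w : V} (h : IsChild T root u w) :
    T.dist root w = T.dist root u + 1 :=
  h.2 ▸ dist_par hT h.1

/-- `v` is an ancestor of `u`, possibly `u` itself. -/
def Anc (T : SimpleGraph V) (root v u : V) : Prop := ∃ j : ℕ, (par T root)^[j] u = v

lemma Anc.refl (v : V) : Anc T root v v := ⟨0, rfl⟩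

lemma Anc.of_child {v u w : V} (h : Anc T root v u) (hw : IsChild T root u w) :
    Anc T root v w := by
  obtain ⟨j, rfl⟩ := h
  exact ⟨j + 1, by rw [Function.iterate_succ_apply, hw.2]⟩

lemma Anc.par {v u : V} (h : Anc T root v u) (hne : u ≠ v) :
    Anc T root v (par T root u) := by
  obtain ⟨j, hj⟩ := h
  cases j with
  | zero => exact absurd hj hne
  | succ j => exact ⟨j, by rwa [Function.iterate_succ_apply] at hj⟩

lemma iterate_par_root (j : ℕ) : (BFDN.par T root)^[j] root = root :=
  Function.iterate_fixed par_root j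

lemma Anc.eq_root {v : V} (h : Anc T root v root) : v = root := by
  obtain ⟨j, rfl⟩ := h
  exact iterate_par_root j

lemma dist_iterate_par (hT : T.IsTree) (j : ℕ) (u : V) :
    T.dist root ((BFDN.par T root)^[j] u) = T.dist root u - j := by
  induction j with
  | zero => simp
  | succ j ih =>
    rw [Function.iterate_succ_apply']
    by_cases h : (BFDN.par T root)^[j] u = root
    · rw [h] at ih ⊢
      simp at ih ⊢
      lia
    · have := dist_par hT h
      lia

lemma Anc.eq_of_dist_eq (hT : T.IsTree) {v w u : V} (hv : Anc T root v u) (hw : Anc T root w u)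
    (h : T.dist root v = T.dist root w) : v = w := by
  obtain ⟨j, rfl⟩ := hv
  obtain ⟨l, rfl⟩ := hw
  by_cases h0 : T.dist root ((BFDN.par T root)^[j] u) = 0
  · have h1 := h0
    rw [h] at h1
    rw [(dist_eq_zero_iff_root hT).1 h0, (dist_eq_zero_iff_root hT).1 h1]
  · rw [dist_iterate_par hT] at h h0
    rw [dist_iterate_par hT] at h
    rw [show j = l by lia]

/-- The list `l` consists of the edges of the path that descends from `u` to `a`. -/
def Descends (T : SimpleGraph V) (root : V) : V → List (Sym2 V) → V → Prop
  | u, [], a => u = a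
  | u, e :: l, a => ∃ w, IsChild T root u w ∧ e = s(u, w) ∧ Descends T root w l a

lemma Descends.dist (hT : T.IsTree) {u a : V} {l : List (Sym2 V)} (h : Descends T root u l a) :
    T.dist root a = T.dist root u + l.length := by
  induction l generalizing u with
  | nil => simp [show u = a from h]
  | cons e l ih =>
    obtain ⟨w, hw, -, h⟩ := h
    rw [ih h, hw.dist hT, List.length_cons]
    lia

/-- A path that does not start with a step to the parent only goes down. -/
lemma descends_of_isPath (hT : T.IsTree) {u a : V} (p : T.Walk u a) (hp : p.IsPath)
    (hu : u = root ∨ par T root u ∉ p.support) : Descends T root u p.edges a := by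
  induction p with
  | nil => rfl
  | @cons u w a h q ih =>
    rw [SimpleGraph.Walk.cons_isPath_iff] at hp
    have hc : IsChild T root u w := by
      refine (par_or_par_of_adj hT h).resolve_left ?_
      rintro ⟨h1, h2⟩
      refine hu.elim h1 fun h3 => h3 ?_
      simp [h2]
    refine ⟨w, hc, rfl, ih hp.1 (.inr ?_)⟩
    rw [hc.2]
    exact hp.2

/-- A set of nodes that contains the root but not `v` is left, on the way from the root to `v`,
through some node that is not in the set while its parent is. -/
lemma exists_first_not_mem (hT : T.IsTree) {S : Set V} (h0 : root ∈ S) {v : V} (hv : v ∉ S) :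
    ∃ w, w ≠ root ∧ w ∉ S ∧ par T root w ∈ S ∧ T.dist root w ≤ T.dist root v := by
  induction h : T.dist root v generalizing v with
  | zero => exact absurd ((dist_eq_zero_iff_root hT).1 h ▸ h0) hv
  | succ d ih =>
    have hr : v ≠ root := by rintro rfl; exact hv h0
    by_cases hp : par T root v ∈ S
    · exact ⟨v, hr, hv, hp, h.le⟩
    · obtain ⟨w, h1, h2, h3, h4⟩ := ih hp (by have := dist_par hT hr; lia)
      exact ⟨w, h1, h2, h3, by lia⟩

end Tree

/-! ### What a round does to each robot -/

section Rounds
variable {V : Type*} {k : ℕ} {T : SimpleGraph V} {root : V}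

lemma target_some (u w : V) : target u (some s(u, w)) = w := by
  rw [target, dif_pos (Sym2.mem_mk_left u w)]
  exact Sym2.congr_right.1 (Sym2.other_spec (Sym2.mem_mk_left u w))

/-- The facts about a reachable state that the analysis relies on. -/
structure Inv (T : SimpleGraph V) (root : V) (s : State V k) : Prop where
  root_mem : root ∈ s.discovered
  par_mem : ∀ v ∈ s.discovered, par T root v ∈ s.discovered
  par_explored : ∀ v ∈ s.discovered, v ≠ root → s(v, par T root v) ∈ s.explored
  explored_sub : s.explored ⊆ T.edgeSet
  explored_discovered : ∀ e ∈ s.explored, ∀ v ∈ e, v ∈ s.discovered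
  pos_mem : ∀ i, s.pos i ∈ s.discovered
  anchor_mem : ∀ i, s.anchor i ∈ s.discovered
  stack_descends : ∀ i, s.stack i ≠ [] → Descends T root (s.pos i) (s.stack i) (s.anchor i)
  stack_root : ∀ i, s.pos i = root → s.stack i = []
  /-- Anchors are at most as deep as the open nodes. -/
  anchor_le : ∀ i, ∀ u ∈ s.openNodes T, T.dist root (s.anchor i) ≤ T.dist root u
  /-- A robot that has reached its anchor stays below it as long as the anchor is open. -/
  below_anchor : ∀ i, s.stack i = [] →
    Anc T root (s.anchor i) (s.pos i) ∨ s.anchor i ∉ s.openNodes T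
  /-- Below every open node there is a robot with an anchor of smaller depth, for instance the
  robot that discovered the node. -/
  guard : ∀ v ∈ s.openNodes T, v ≠ root →
    ∃ i, s.stack i = [] ∧ Anc T root v (s.pos i) ∧ T.dist root (s.anchor i) < T.dist root v

/-- The four things that can happen to robot `i` in a round from `s` to `s'`: it follows its stack,
it traverses a dangling edge, it goes back towards the root, or it stays at the root. The last two
happen only if all dangling edges at its position are traversed in this round. -/
inductive Outcome (T : SimpleGraph V) (root : V) (s s' : State V k) (i : Fin k) : Prop
  | follow (hs : s.pos i ≠ root → s.stack i = s(s.pos i, s'.pos i) :: s'.stack i)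
      (hc : IsChild T root (s.pos i) (s'.pos i))
      (hd : Descends T root (s'.pos i) (s'.stack i) (s'.anchor i))
      (hm : s'.pos i ∈ s.discovered)
  | discover (hs : s.pos i ≠ root → s.stack i = []) (hr : s.pos i = root → s'.anchor i = root)
      (hs' : s'.stack i = []) (hc : IsChild T root (s.pos i) (s'.pos i))
      (he : s(s.pos i, s'.pos i) ∈ s.dangling T)
  | back (hp : s.pos i ≠ root) (hs : s.stack i = []) (hs' : s'.stack i = [])
      (hp' : s'.pos i = par T root (s.pos i))
      (hcl : ∀ e ∈ s.dangling T, s.pos i ∈ e → e ∈ s'.explored)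
  | stay (hp : s.pos i = root) (hp' : s'.pos i = root) (hs' : s'.stack i = [])
      (hr : s'.anchor i = root)
      (hcl : ∀ e ∈ s.dangling T, s.pos i ∈ e → e ∈ s'.explored)

/-- The effect of a round, without the order of the turns. -/
structure Step (T : SimpleGraph V) (root : V) (s s' : State V k) : Prop where
  outcome : ∀ i, Outcome T root s s' i
  anchor_root : ∀ i, s.pos i = root →
    s'.anchor i ∈ s.candidates T root ∨ (s.candidates T root = ∅ ∧ s'.anchor i = root)
  anchor_same : ∀ i, s.pos i ≠ root → s'.anchor i = s.anchor i
  discovered_iff : ∀ v, v ∈ s'.discovered ↔ v ∈ s.discovered ∨ ∃ i, v = s'.pos i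
  explored_iff : ∀ e, e ∈ s'.explored ↔
    e ∈ s.explored ∨ ∃ i, s'.pos i ≠ s.pos i ∧ e = s(s.pos i, s'.pos i)
  /-- No two robots traverse the same dangling edge in the same round. -/
  injective : ∀ i j, s(s.pos i, s'.pos i) ∈ s.dangling T →
    s(s.pos i, s'.pos i) = s(s.pos j, s'.pos j) → i = j

/-- `m` lists the memories between the turns of a round from `s` to `s'`. -/
def Trace [DecidableEq V] (T : SimpleGraph V) (root : V) (s s' : State V k)
    (m : Fin (k + 1) → Memory V k) : Prop :=
  m 0 = { anchor := s.anchor, stack := s.stack, selected := fun _ => none } ∧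
    (∀ i : Fin k, Turn T root s i (m i.castSucc) (m i.succ)) ∧ s' = s.move (m (Fin.last k))

lemma Turn.other [DecidableEq V] {s : State V k} {i j : Fin k} {m m' : Memory V k}
    (h : Turn T root s i m m') (hj : j ≠ i) :
    m'.anchor j = m.anchor j ∧ m'.stack j = m.stack j ∧ m'.selected j = m.selected j := by
  obtain ⟨m₁, h1, h2⟩ := h
  have e1 : m₁.anchor j = m.anchor j ∧ m₁.stack j = m.stack j ∧ m₁.selected j = m.selected j := by
    rcases h1 with ⟨-, a, p, -, -, rfl⟩ | ⟨-, rfl⟩ <;> simp [hj]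
  rw [← e1.1, ← e1.2.1, ← e1.2.2]
  rcases h2 with ⟨-, e, l, -, rfl⟩ | ⟨-, o, -, rfl⟩ <;> simp [hj]

lemma eq_of_forall_ne {α : Type*} {f : Fin (k + 1) → α} {r : Fin k}
    (h : ∀ i : Fin k, i ≠ r → f i.succ = f i.castSucc) (x : Fin (k + 1)) :
    f x = if r.castSucc < x then f (Fin.last k) else f 0 := by
  split_ifs with hx
  · induction x using Fin.reverseInduction with
    | last => rfl
    | cast i ih =>
      rw [← h i (by rintro rfl; exact lt_irrefl _ hx), ih (hx.trans (Fin.castSucc_lt_succ))]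
  · induction x using Fin.induction with
    | zero => rfl
    | succ i ih =>
      have hi : i < r := by
        rw [not_lt, Fin.le_def] at hx
        rw [Fin.lt_def]
        simp at hx
        lia
      rw [h i hi.ne, ih (by simpa using hi.le)]

lemma Descends.mem {s : State V k} (hI : Inv T root s) {u a : V} {l : List (Sym2 V)}
    (h : Descends T root u l a) (ha : a ∈ s.discovered) : u ∈ s.discovered := by
  induction l generalizing u with
  | nil => exact (show u = a from h) ▸ ha
  | cons e l ih =>
    obtain ⟨w, hw, -, h⟩ := h
    exact hw.2 ▸ hI.par_mem _ (ih h)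

lemma Inv.isChild_of_dangling {s : State V k} (hT : T.IsTree) (hI : Inv T root s) {u w : V}
    (hu : u ∈ s.discovered) (he : s(u, w) ∈ s.dangling T) : IsChild T root u w := by
  refine (par_or_par_of_adj hT he.1).resolve_left ?_
  rintro ⟨h1, h2⟩
  have h3 := hI.par_explored u hu h1
  rw [show par T root u = w from h2] at h3
  exact he.2.2 h3

section Trace
variable [DecidableEq V] {s s' : State V k} {m : Fin (k + 1) → Memory V k}

lemma Trace.anchor_eq (h : Trace T root s s' m) (x : Fin (k + 1)) (r : Fin k) :
    (m x).anchor r = if r.castSucc < x then s'.anchor r else s.anchor r := by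
  obtain ⟨h0, ht, rfl⟩ := h
  have := eq_of_forall_ne (f := fun x => (m x).anchor r) (r := r)
    (fun i hi => ((ht i).other hi.symm).1) x
  simpa [h0, State.move] using this

lemma Trace.stack_eq (h : Trace T root s s' m) (x : Fin (k + 1)) (r : Fin k) :
    (m x).stack r = if r.castSucc < x then s'.stack r else s.stack r := by
  obtain ⟨h0, ht, rfl⟩ := h
  have := eq_of_forall_ne (f := fun x => (m x).stack r) (r := r)
    (fun i hi => ((ht i).other hi.symm).2.1) x
  simpa [h0, State.move] using this

lemma Trace.selected_eq (h : Trace T root s s' m) (x : Fin (k + 1)) (r : Fin k) :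
    (m x).selected r = if r.castSucc < x then (m (Fin.last k)).selected r else none := by
  obtain ⟨h0, ht, rfl⟩ := h
  have := eq_of_forall_ne (f := fun x => (m x).selected r) (r := r)
    (fun i hi => ((ht i).other hi.symm).2.2) x
  simpa [h0] using this

/-- The turn of robot `i`, in terms of the states before and after the round. Here `l` is the stack
of the robot once it may have received a new anchor. -/
lemma Trace.turn (h : Trace T root s s' m) (i : Fin k) :
    ∃ l : List (Sym2 V),
      ((s.pos i = root ∧ (∃ p : T.Walk root (s'.anchor i), p.IsPath ∧ l = p.edges) ∧
          Reanchor T root s (m i.castSucc) (s'.anchor i)) ∨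
        (s.pos i ≠ root ∧ s'.anchor i = s.anchor i ∧ l = s.stack i)) ∧
      ((∃ e, l = e :: s'.stack i ∧ (m (Fin.last k)).selected i = some e) ∨
        (l = [] ∧ s'.stack i = [] ∧
          ((∃ e ∈ s.dangling T, s.pos i ∈ e ∧ (m (Fin.last k)).selected i = some e ∧
              ∀ j < i, (m (Fin.last k)).selected j ≠ some e) ∨
            (IsUp T root (s.pos i) ((m (Fin.last k)).selected i) ∧
              ∀ e ∈ s.dangling T, s.pos i ∈ e →
                ∃ j, (m (Fin.last k)).selected j = some e)))) := by
  obtain ⟨m₁, h1, h2⟩ := h.2.1 i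
  have ha := h.anchor_eq i.succ i
  have ha0 := h.anchor_eq i.castSucc i
  have hs := h.stack_eq i.succ i
  have hs0 := h.stack_eq i.castSucc i
  have hl := h.selected_eq i.succ i
  simp only [Fin.castSucc_lt_succ, if_true, lt_irrefl, if_false] at ha ha0 hs hs0 hl
  have hsel : ∀ j, m₁.selected j = (m i.castSucc).selected j := by
    intro j
    rcases h1 with ⟨-, a, p, -, -, rfl⟩ | ⟨-, rfl⟩ <;> rfl
  have hanc : (m i.succ).anchor i = m₁.anchor i := by
    rcases h2 with ⟨-, e, l, -, h2⟩ | ⟨-, o, -, h2⟩ <;> rw [h2]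
  refine ⟨m₁.stack i, ?_, ?_⟩
  · rw [ha] at hanc
    rcases h1 with ⟨hp, a, p, hr, hpath, rfl⟩ | ⟨hp, rfl⟩
    · simp only [Function.update_self] at hanc ⊢
      subst hanc
      exact .inl ⟨hp, ⟨p, hpath, rfl⟩, hr⟩
    · exact .inr ⟨hp, by rw [hanc, ha0], hs0⟩
  · rw [← hs, ← hl]
    rcases h2 with ⟨-, e, l, he, h2⟩ | ⟨he, o, ho, h2⟩
    · exact .inl ⟨e, by simp [h2, he], by simp [h2]⟩
    · refine .inr ⟨he, by simp [h2, he], ?_⟩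
      simp only [h2, Function.update_self]
      rcases ho with ⟨e, ⟨h3, h4, h5⟩, rfl⟩ | ⟨h3, h4⟩
      · refine .inl ⟨e, h3, h4, rfl, fun j hj h6 => h5 j ?_⟩
        rw [hsel, h.selected_eq, if_pos (by simpa using hj), h6]
      · refine .inr ⟨h4, fun e he hpe => ?_⟩
        by_contra! hcon
        refine (Set.eq_empty_iff_forall_notMem.1 h3 e) ⟨he, hpe, fun j hj => ?_⟩
        rw [hsel, h.selected_eq] at hj
        split_ifs at hj
        exact hcon j hj

lemma Trace.step (hT : T.IsTree) (hI : Inv T root s) (h : Trace T root s s' m) :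
    Step T root s s' := by
  have hpos : ∀ i, s'.pos i = target (s.pos i) ((m (Fin.last k)).selected i) := by
    intro i; rw [h.2.2]; rfl
  have hexp : ∀ e, e ∈ s'.explored ↔
      e ∈ s.explored ∨ ∃ i, (m (Fin.last k)).selected i = some e := by
    intro e; rw [h.2.2]; rfl
  have hcan : ∀ i, s'.anchor i ∈ s.discovered := by
    intro i
    obtain ⟨l, h1, -⟩ := h.turn i
    rcases h1 with ⟨-, -, hr⟩ | ⟨-, h1, -⟩
    · rcases hr with ⟨hr, -⟩ | ⟨-, hr⟩
      · exact hr.1.1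
      · exact hr ▸ hI.root_mem
    · exact h1 ▸ hI.anchor_mem i
  -- Each robot either traverses the edge it has selected or stays at the root.
  have key : ∀ i, Outcome T root s s' i ∧
      ((m (Fin.last k)).selected i = some s(s.pos i, s'.pos i) ∧ s'.pos i ≠ s.pos i ∨
        (m (Fin.last k)).selected i = none ∧ s'.pos i = s.pos i) ∧
      (s(s.pos i, s'.pos i) ∈ s.dangling T →
        ∀ j < i, (m (Fin.last k)).selected j ≠ some s(s.pos i, s'.pos i)) := by
    intro i
    obtain ⟨l, h1, h2⟩ := h.turn i
    have hdesc : l ≠ [] ∨ s.pos i = root → Descends T root (s.pos i) l (s'.anchor i) := by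
      intro hl
      rcases h1 with ⟨hp, ⟨p, hpath, rfl⟩, -⟩ | ⟨hp, ha, rfl⟩
      · rw [hp]
        exact descends_of_isPath hT p hpath (.inl rfl)
      · rw [ha]
        exact hI.stack_descends i (hl.resolve_right hp)
    have hold : s.pos i ≠ root → s.stack i = l := by
      intro hp
      rcases h1 with ⟨hp', -⟩ | ⟨-, -, rfl⟩
      · exact absurd hp' hp
      · rfl
    rcases h2 with ⟨e, rfl, hsel⟩ | ⟨rfl, hs', h2⟩
    · obtain ⟨w, hw, rfl, hd⟩ := hdesc (.inl (by simp))
      have hw' : s'.pos i = w := by rw [hpos, hsel, target_some]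
      subst hw'
      have hm := hd.mem hI (hcan i)
      have hnd : s(s.pos i, s'.pos i) ∉ s.dangling T := by
        intro he
        have := hI.par_explored _ hm hw.1
        rw [hw.2, Sym2.eq_swap] at this
        exact he.2.2 this
      exact ⟨.follow hold hw hd hm, .inl ⟨hsel, (hw.adj hT).ne'⟩, fun he => absurd he hnd⟩
    · have hroot : s.pos i = root → s'.anchor i = root := by
        intro hp
        have : s.pos i = s'.anchor i := hdesc (.inr hp)
        rw [← this, hp]
      rcases h2 with ⟨e, he, hpe, hsel, hj⟩ | ⟨hup, hcl⟩
      · obtain ⟨w, rfl⟩ := hpe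
        have hw' : s'.pos i = w := by rw [hpos, hsel, target_some]
        subst hw'
        have hc := hI.isChild_of_dangling hT (hI.pos_mem i) he
        exact ⟨.discover hold hroot hs' hc he, .inl ⟨hsel, (hc.adj hT).ne'⟩, fun _ => hj⟩
      · have hcl' : ∀ e ∈ s.dangling T, s.pos i ∈ e → e ∈ s'.explored :=
          fun e he hpe => (hexp e).2 (.inr (hcl e he hpe))
        rcases hup with ⟨hp, hsel⟩ | ⟨hp, w, hadj, hdist, hsel⟩
        · have hp' : s'.pos i = s.pos i := by rw [hpos, hsel]; rfl
          refine ⟨.stay hp (hp'.trans hp) hs' (hroot hp) hcl', .inr ⟨hsel, hp'⟩, fun he => ?_⟩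
          rw [hp'] at he
          exact absurd he.1 (by simp)
        · have hw' : s'.pos i = w := by rw [hpos, hsel, target_some]
          subst hw'
          have hpar := eq_par hT hadj hdist
          refine ⟨.back hp (hold hp) hs' hpar hcl', .inl ⟨hsel, hadj.ne'⟩, fun he => ?_⟩
          rw [hpar] at he
          exact absurd (hI.par_explored _ (hI.pos_mem i) hp) he.2.2
  have hsel : ∀ i e, (m (Fin.last k)).selected i = some e ↔
      s'.pos i ≠ s.pos i ∧ e = s(s.pos i, s'.pos i) := by
    intro i e
    rcases (key i).2.1 with ⟨h1, h2⟩ | ⟨h1, h2⟩ <;> simp [h1, h2, eq_comm]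
  refine ⟨fun i => (key i).1, fun i hp => ?_, fun i hp => ?_, ?_, fun e => ?_, ?_⟩
  · obtain ⟨l, h1, -⟩ := h.turn i
    rcases h1 with ⟨-, -, hr⟩ | ⟨h1, -⟩
    · exact hr.imp And.left id
    · exact absurd hp h1
  · obtain ⟨l, h1, -⟩ := h.turn i
    rcases h1 with ⟨h1, -⟩ | ⟨-, h1, -⟩
    · exact absurd h1 hp
    · exact h1
  · intro v; simp only [hpos]; rw [h.2.2]; rfl
  · rw [hexp]; simp only [hsel]
  · intro i j hi hij
    have hmoved : ∀ r, s(s.pos r, s'.pos r) ∈ s.dangling T → s'.pos r ≠ s.pos r := by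
      rintro r ⟨hr, -⟩ h0
      rw [h0] at hr
      simp at hr
    rcases lt_trichotomy i j with hlt | rfl | hlt
    · refine absurd ?_ ((key j).2.2 (hij ▸ hi) i hlt)
      exact (hsel i _).2 ⟨hmoved i hi, hij.symm⟩
    · rfl
    · refine absurd ?_ ((key i).2.2 hi j hlt)
      exact (hsel j _).2 ⟨hmoved j (hij ▸ hi), hij⟩

end Trace

/-! ### The invariant -/

section Step
variable {s s' : State V k}

lemma Inv.exists_open_of_not_mem (hT : T.IsTree) (hI : Inv T root s) {v : V}
    (hv : v ∉ s.discovered) : ∃ u ∈ s.openNodes T, T.dist root u < T.dist root v := by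
  obtain ⟨w, h1, h2, h3, h4⟩ := exists_first_not_mem hT hI.root_mem hv
  refine ⟨par T root w, ⟨h3, s(w, par T root w), ⟨adj_par hT h1, ⟨_, by simp, h3⟩, fun h => ?_⟩,
    by simp⟩, by have := dist_par hT h1; lia⟩
  exact h2 (hI.explored_discovered _ h w (by simp))

lemma Step.discovered_mono (h : Step T root s s') : s.discovered ⊆ s'.discovered :=
  fun v hv => (h.discovered_iff v).2 (.inl hv)

lemma Step.explored_mono (h : Step T root s s') : s.explored ⊆ s'.explored :=
  fun e he => (h.explored_iff e).2 (.inl he)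

lemma Step.open_of_open (h : Step T root s s') {v : V} (hv : v ∈ s.discovered)
    (hv' : v ∈ s'.openNodes T) : v ∈ s.openNodes T := by
  obtain ⟨-, e, he, hve⟩ := hv'
  exact ⟨hv, e, ⟨he.1, ⟨v, hve, hv⟩, fun h1 => he.2.2 (h.explored_mono h1)⟩, hve⟩

lemma Step.not_open (h : Step T root s s') {v : V} (hv : v ∈ s.discovered)
    (hcl : ∀ e ∈ s.dangling T, v ∈ e → e ∈ s'.explored) : v ∉ s'.openNodes T := by
  rintro ⟨-, e, he, hve⟩
  exact he.2.2 (hcl e ⟨he.1, ⟨v, hve, hv⟩, fun h1 => he.2.2 (h.explored_mono h1)⟩ hve)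

lemma Step.exists_open_le (hT : T.IsTree) (hI : Inv T root s) (h : Step T root s s') {v : V}
    (hv : v ∈ s'.openNodes T) : ∃ u ∈ s.openNodes T, T.dist root u ≤ T.dist root v := by
  by_cases hd : v ∈ s.discovered
  · exact ⟨v, h.open_of_open hd hv, le_rfl⟩
  · obtain ⟨u, h1, h2⟩ := hI.exists_open_of_not_mem hT hd
    exact ⟨u, h1, h2.le⟩

lemma Step.anchor_mem (hI : Inv T root s) (h : Step T root s s') (i : Fin k) :
    s'.anchor i ∈ s.discovered := by
  by_cases hp : s.pos i = root
  · rcases h.anchor_root i hp with h1 | ⟨-, h1⟩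
    · exact h1.1.1
    · exact h1 ▸ hI.root_mem
  · exact h.anchor_same i hp ▸ hI.anchor_mem i

lemma Step.edge_explored (h : Step T root s s') {i : Fin k} (hi : s'.pos i ≠ s.pos i) :
    s(s.pos i, s'.pos i) ∈ s'.explored :=
  (h.explored_iff _).2 (.inr ⟨i, hi, rfl⟩)

lemma Inv.init : Inv T root (State.init root : State V k) where
  root_mem := rfl
  par_mem := by rintro v rfl; exact par_root
  par_explored := fun v hv hr => absurd hv hr
  explored_sub := fun e he => absurd he (Set.notMem_empty e)
  explored_discovered := fun e he => absurd he (Set.notMem_empty e)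
  pos_mem := fun _ => rfl
  anchor_mem := fun _ => rfl
  stack_descends := fun _ h => absurd rfl h
  stack_root := fun _ _ => rfl
  anchor_le := by simp [State.init]
  below_anchor := fun _ _ => .inl (Anc.refl root)
  guard := fun v hv hr => absurd hv.1 hr

lemma Inv.step (hT : T.IsTree) (hI : Inv T root s) (h : Step T root s s') : Inv T root s' := by
  -- A robot ends the round at a discovered node unless it has traversed a dangling edge.
  have hnew : ∀ i, s'.pos i ∈ s.discovered ∨
      (s'.stack i = [] ∧ IsChild T root (s.pos i) (s'.pos i) ∧
        s(s.pos i, s'.pos i) ∈ s.dangling T ∧ (s.pos i = root → s'.anchor i = root)) := by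
    intro i
    cases h.outcome i with
    | follow hs hc hd hm => exact .inl hm
    | discover hs hr hs' hc he => exact .inr ⟨hs', hc, he, hr⟩
    | back hp hs hs' hp' hcl => exact .inl (hp' ▸ hI.par_mem _ (hI.pos_mem i))
    | stay hp hp' hs' hr hcl => exact .inl (hp' ▸ hI.root_mem)
  have hpos : ∀ i, s'.pos i ∈ s'.discovered := fun i => (h.discovered_iff _).2 (.inr ⟨i, rfl⟩)
  have hadj : ∀ i, s'.pos i ≠ s.pos i → T.Adj (s.pos i) (s'.pos i) := by
    intro i hi
    cases h.outcome i with
    | follow hs hc hd hm => exact hc.adj hT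
    | discover hs hr hs' hc he => exact hc.adj hT
    | back hp hs hs' hp' hcl => exact hp' ▸ adj_par hT hp
    | stay hp hp' hs' hr hcl => exact absurd (hp'.trans hp.symm) hi
  refine ⟨h.discovered_mono hI.root_mem, fun v hv => ?_, fun v hv hr => ?_, fun e he => ?_,
    fun e he v hv => ?_, hpos, fun i => h.discovered_mono (h.anchor_mem hI i), fun i hi => ?_,
    fun i hi => ?_, fun i u hu => ?_, fun i hi => ?_, fun v hv hr => ?_⟩
  · rcases (h.discovered_iff v).1 hv with hv | ⟨i, rfl⟩
    · exact h.discovered_mono (hI.par_mem v hv)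
    · rcases hnew i with h1 | ⟨-, h1, -⟩
      · exact h.discovered_mono (hI.par_mem _ h1)
      · rw [h1.2]
        exact h.discovered_mono (hI.pos_mem i)
  · rcases (h.discovered_iff v).1 hv with hv | ⟨i, rfl⟩
    · exact h.explored_mono (hI.par_explored v hv hr)
    · rcases hnew i with h1 | ⟨-, h1, -⟩
      · exact h.explored_mono (hI.par_explored _ h1 hr)
      · rw [h1.2, Sym2.eq_swap]
        exact h.edge_explored (h1.adj hT).ne'
  · rcases (h.explored_iff e).1 he with he | ⟨i, h1, rfl⟩
    · exact hI.explored_sub he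
    · exact hadj i h1
  · rcases (h.explored_iff e).1 he with he | ⟨i, h1, rfl⟩
    · exact h.discovered_mono (hI.explored_discovered e he v hv)
    · rcases Sym2.mem_iff.1 hv with rfl | rfl
      · exact h.discovered_mono (hI.pos_mem i)
      · exact hpos i
  · cases h.outcome i with
    | follow hs hc hd hm => exact hd
    | discover hs hr hs' hc he => exact absurd hs' hi
    | back hp hs hs' hp' hcl => exact absurd hs' hi
    | stay hp hp' hs' hr hcl => exact absurd hs' hi
  · cases h.outcome i with
    | follow hs hc hd hm => exact absurd hi hc.1
    | discover hs hr hs' hc he => exact hs'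
    | back hp hs hs' hp' hcl => exact hs'
    | stay hp hp' hs' hr hcl => exact hs'
  · obtain ⟨u', h1, h2⟩ := h.exists_open_le hT hI hu
    refine le_trans ?_ h2
    by_cases hp : s.pos i = root
    · rcases h.anchor_root i hp with h3 | ⟨-, h3⟩
      · exact h3.2 u' h1
      · simp [h3]
    · rw [h.anchor_same i hp]
      exact hI.anchor_le i u' h1
  · have hkeep : s.pos i ≠ root → s.stack i = [] →
        Anc T root (s'.anchor i) (s.pos i) ∨ s'.anchor i ∉ s'.openNodes T := by
      intro hp hs
      rw [h.anchor_same i hp]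
      exact (hI.below_anchor i hs).imp_right fun h1 h2 =>
        h1 (h.open_of_open (hI.anchor_mem i) h2)
    cases h.outcome i with
    | follow hs hc hd hm =>
      rw [hi] at hd
      exact .inl ⟨0, hd⟩
    | discover hs hr hs' hc he =>
      by_cases hp : s.pos i = root
      · rw [hr hp]
        rw [hp] at hc
        exact .inl ((Anc.refl root).of_child hc)
      · exact (hkeep hp (hs hp)).imp_left fun h1 => h1.of_child hc
    | back hp hs hs' hp' hcl =>
      rcases hkeep hp hs with h1 | h1
      · by_cases h2 : s.pos i = s'.anchor i
        · exact .inr (h2 ▸ h.not_open (hI.pos_mem i) hcl)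
        · exact .inl (hp' ▸ h1.par h2)
      · exact .inr h1
    | stay hp hp' hs' hr hcl =>
      rw [hr, hp']
      exact .inl (Anc.refl root)
  · by_cases hd : v ∈ s.discovered
    · obtain ⟨i, h1, h2, h3⟩ := hI.guard v (h.open_of_open hd hv) hr
      have hp : s.pos i ≠ root := fun hp => hr ((hp ▸ h2 : Anc T root v root).eq_root)
      rw [← h.anchor_same i hp] at h3
      cases h.outcome i with
      | follow hs hc hd hm => simp [hs hp] at h1
      | discover hs hr' hs' hc he => exact ⟨i, hs', h2.of_child hc, h3⟩
      | back hp hs hs' hp' hcl =>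
        refine ⟨i, hs', ?_, h3⟩
        rw [hp']
        refine h2.par fun h4 => ?_
        exact h.not_open hd (h4 ▸ hcl) hv
      | stay hp' _ _ _ _ => exact absurd hp' hp
    · obtain ⟨i, rfl⟩ := ((h.discovered_iff v).1 hv.1).resolve_left hd
      obtain ⟨h1, h2, h3, h4⟩ := (hnew i).resolve_left hd
      refine ⟨i, h1, Anc.refl _, ?_⟩
      rw [h2.dist hT, Nat.lt_succ_iff]
      by_cases hp : s.pos i = root
      · simp [h4 hp]
      · rw [h.anchor_same i hp]
        exact hI.anchor_le i _ ⟨hI.pos_mem i, _, h3, by simp⟩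

end Step
end Rounds

/-! ### Existence of runs -/

section Existence
variable {V : Type*} [Fintype V] [DecidableEq V] {k : ℕ} {T : SimpleGraph V} {root : V}

lemma exists_anchorStep (hT : T.IsTree) (s : State V k) (i : Fin k) (m : Memory V k) :
    ∃ m', AnchorStep T root s i m m' := by
  by_cases hp : s.pos i = root
  · obtain ⟨a, ha⟩ : ∃ a, Reanchor T root s m a := by
      rcases (s.candidates T root).eq_empty_or_nonempty with h | h
      · exact ⟨root, .inr ⟨h, rfl⟩⟩
      · obtain ⟨a, h1, h2⟩ := Set.exists_min_image _ m.load (Set.toFinite _) h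
        exact ⟨a, .inl ⟨h1, h2⟩⟩
    obtain ⟨p, hpath, -⟩ := hT.connected.exists_path_of_dist root a
    exact ⟨_, .inl ⟨hp, a, p, ha, hpath, rfl⟩⟩
  · exact ⟨m, .inr ⟨hp, rfl⟩⟩

lemma exists_turn (hT : T.IsTree) (s : State V k) (i : Fin k) (m : Memory V k) :
    ∃ m', Turn T root s i m m' := by
  obtain ⟨m₁, h1⟩ := exists_anchorStep (root := root) hT s i m
  cases hs : m₁.stack i with
  | cons e l => exact ⟨_, m₁, h1, .inl ⟨by simp [hs], e, l, hs, rfl⟩⟩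
  | nil =>
    obtain ⟨o, ho⟩ : ∃ o, (∃ e ∈ available T s i m₁, o = some e) ∨
        (available T s i m₁ = ∅ ∧ IsUp T root (s.pos i) o) := by
      rcases (available T s i m₁).eq_empty_or_nonempty with h | ⟨e, he⟩
      · by_cases hp : s.pos i = root
        · exact ⟨none, .inr ⟨h, .inl ⟨hp, rfl⟩⟩⟩
        · obtain ⟨w, h2, h3⟩ := exists_closer hT hp
          exact ⟨_, .inr ⟨h, .inr ⟨hp, w, h2, h3, rfl⟩⟩⟩
      · exact ⟨some e, .inl ⟨e, he, rfl⟩⟩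
    exact ⟨_, m₁, h1, .inr ⟨hs, o, ho, rfl⟩⟩

lemma exists_round (hT : T.IsTree) (s : State V k) : ∃ s', Round T root s s' := by
  choose f hf using fun i m => exists_turn (root := root) hT s i m
  refine ⟨_, fun x => Fin.induction (motive := fun _ => Memory V k)
    { anchor := s.anchor, stack := s.stack, selected := fun _ => none } (fun i m => f i m) x,
    rfl, fun i => ?_, rfl⟩
  simp only [Fin.induction_succ]
  exact hf _ _

lemma exists_run (hT : T.IsTree) (k : ℕ) : ∃ s : ℕ → State V k, IsRun T root s := by
  choose f hf using fun s : State V k => exists_round (root := root) hT s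
  exact ⟨fun t => Nat.rec (State.init root) (fun _ s => f s) t, rfl, fun t => hf _⟩

end Existence

/-! ### Runs -/

section Runs
variable {V : Type*} [DecidableEq V] {k : ℕ} {T : SimpleGraph V} {root : V}
  {s : ℕ → State V k} {m : ℕ → Fin (k + 1) → Memory V k}

/-- A run on a tree, together with the memories between the turns of its rounds. -/
structure TracedRun (T : SimpleGraph V) (root : V) (s : ℕ → State V k)
    (m : ℕ → Fin (k + 1) → Memory V k) : Prop where
  isTree : T.IsTree
  zero : s 0 = State.init root
  trace : ∀ t, Trace T root (s t) (s (t + 1)) (m t)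

lemma IsRun.exists_tracedRun (hT : T.IsTree) (h : IsRun T root s) :
    ∃ m, TracedRun T root s m := by
  choose m hm using h.2
  exact ⟨m, hT, h.1, hm⟩

/-- Robot `i` receives in round `t` an anchor of depth `d`. -/
def Assigned (T : SimpleGraph V) (root : V) (s : ℕ → State V k) (d t : ℕ) (i : Fin k) : Prop :=
  (s t).pos i = root ∧ T.dist root ((s (t + 1)).anchor i) = d

omit [DecidableEq V] in
lemma Assigned.ne_root {d t : ℕ} {i : Fin k} (ha : Assigned T root s d t i) (hd : 1 ≤ d) :
    (s (t + 1)).anchor i ≠ root := by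
  intro h1
  have := ha.2
  rw [h1, SimpleGraph.dist_self] at this
  lia

/-- The number of robots already anchored at the new anchor of robot `i` when robot `i` is about to
take its turn in round `t`. -/
def loadBefore (s : ℕ → State V k) (m : ℕ → Fin (k + 1) → Memory V k) (t : ℕ) (i : Fin k) : ℕ :=
  (m t i.castSucc).load ((s (t + 1)).anchor i)

namespace TracedRun
variable (h : TracedRun T root s m)
include h

lemma inv (t : ℕ) : Inv T root (s t) := by
  induction t with
  | zero => exact h.zero ▸ Inv.init
  | succ t ih => exact ih.step h.isTree ((h.trace t).step h.isTree ih)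

lemma step (t : ℕ) : Step T root (s t) (s (t + 1)) := (h.trace t).step h.isTree (h.inv t)

lemma discovered_mono {t t' : ℕ} (ht : t ≤ t') : (s t).discovered ⊆ (s t').discovered :=
  monotone_nat_of_le_succ (f := fun t => (s t).discovered)
    (fun t => (h.step t).discovered_mono) ht

lemma explored_mono {t t' : ℕ} (ht : t ≤ t') : (s t).explored ⊆ (s t').explored :=
  monotone_nat_of_le_succ (f := fun t => (s t).explored) (fun t => (h.step t).explored_mono) ht

lemma open_of_open {t t' : ℕ} (ht : t ≤ t') {v : V} (hv : v ∈ (s t).discovered)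
    (hv' : v ∈ (s t').openNodes T) : v ∈ (s t).openNodes T := by
  induction t', ht using Nat.le_induction with
  | base => exact hv'
  | succ t' ht ih => exact ih ((h.step t').open_of_open (h.discovered_mono ht hv) hv')

lemma dangling_ne_empty {t t' : ℕ} (ht : t ≤ t') (hd : (s t').dangling T ≠ ∅) :
    (s t).dangling T ≠ ∅ := by
  obtain ⟨e, he⟩ := Set.nonempty_iff_ne_empty.2 hd
  obtain ⟨u, hu, hu'⟩ := he.2.1
  have hop : u ∈ (s t').openNodes T := ⟨hu', e, he, hu⟩
  have : ∃ v, v ∈ (s t).openNodes T := by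
    by_cases hv : u ∈ (s t).discovered
    · exact ⟨u, h.open_of_open ht hv hop⟩
    · obtain ⟨v, hv, -⟩ := (h.inv t).exists_open_of_not_mem h.isTree hv
      exact ⟨v, hv⟩
  obtain ⟨v, -, e, he, -⟩ := this
  exact Set.nonempty_iff_ne_empty.1 ⟨e, he⟩

/-- A robot that is anchored at an open node other than the root is not at the root. -/
lemma pos_ne_root {t : ℕ} {r : Fin k} {v : V} (hv : v ≠ root) (hop : v ∈ (s t).openNodes T)
    (hr : (s t).anchor r = v) : (s t).pos r ≠ root := by
  intro hp
  rcases (h.inv t).below_anchor r ((h.inv t).stack_root r hp) with h1 | h1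
  · rw [hp] at h1
    exact hv (hr ▸ h1.eq_root)
  · exact h1 (hr ▸ hop)

lemma anchor_succ {t : ℕ} {r : Fin k} {v : V} (hv : v ≠ root) (hop : v ∈ (s t).openNodes T)
    (hr : (s t).anchor r = v) : (s (t + 1)).anchor r = v := by
  rw [(h.step t).anchor_same r (h.pos_ne_root hv hop hr), hr]

lemma anchor_of_le {t t' : ℕ} (ht : t ≤ t') {r : Fin k} {v : V} (hv : v ≠ root)
    (hop : v ∈ (s t').openNodes T) (hr : (s t).anchor r = v) : (s t').anchor r = v := by
  induction t', ht using Nat.le_induction with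
  | base => exact hr
  | succ t' ht ih =>
    have hd := h.discovered_mono ht (hr ▸ (h.inv t).anchor_mem r : v ∈ (s t).discovered)
    have hop' := (h.step t').open_of_open hd hop
    exact h.anchor_succ hv hop' (ih hop')

lemma anchor_succ_of_mid {t : ℕ} {x : Fin (k + 1)} {r : Fin k} {v : V} (hv : v ≠ root)
    (hop : v ∈ (s t).openNodes T) (hr : (m t x).anchor r = v) : (s (t + 1)).anchor r = v := by
  rw [(h.trace t).anchor_eq] at hr
  split_ifs at hr
  · exact hr
  · exact h.anchor_succ hv hop hr

lemma mid_of_anchor {t : ℕ} {x : Fin (k + 1)} {r : Fin k} {v : V} (hv : v ≠ root)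
    (hop : v ∈ (s t).openNodes T) (hr : (s t).anchor r = v) : (m t x).anchor r = v := by
  rw [(h.trace t).anchor_eq]
  split_ifs
  · exact h.anchor_succ hv hop hr
  · exact hr

/-! ### Assignments of anchors of a given depth -/

section Assigned
variable {d t : ℕ} {i : Fin k} (hd : 1 ≤ d) (ha : Assigned T root s d t i)
include hd ha

lemma assigned_mem : (s (t + 1)).anchor i ∈ (s t).candidates T root :=
  ((h.step t).anchor_root i ha.1).resolve_right fun h1 => ha.ne_root hd h1.2

lemma dist_candidate {v : V} (hv : v ∈ (s t).candidates T root) : T.dist root v = d := by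
  have h1 := h.assigned_mem hd ha
  rw [← ha.2]
  exact le_antisymm (hv.2 _ h1.1) (h1.2 _ hv.1)

lemma candidate_ne_root {v : V} (hv : v ∈ (s t).candidates T root) : v ≠ root := by
  rintro rfl
  have := h.dist_candidate hd ha hv
  simp at this
  lia

lemma loadBefore_le {v : V} (hv : v ∈ (s t).candidates T root) :
    loadBefore s m t i ≤ (m t i.castSucc).load v := by
  obtain ⟨l, ⟨-, -, hr⟩ | ⟨h1, -⟩, -⟩ := (h.trace t).turn i
  · rcases hr with ⟨-, hr⟩ | ⟨-, hr⟩
    · exact hr v hv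
    · exact absurd hr (ha.ne_root hd)
  · exact absurd ha.1 h1

/-- While anchors of depth `d` are assigned, no new candidates appear. -/
lemma candidates_subset {t' : ℕ} {i' : Fin k} (ht : t ≤ t') (ha' : Assigned T root s d t' i') :
    (s t').candidates T root ⊆ (s t).candidates T root := by
  intro v hv
  have hv' := h.dist_candidate hd ha' hv
  have h1 := h.assigned_mem hd ha
  have hdisc : v ∈ (s t).discovered := by
    by_contra hcon
    obtain ⟨u, h2, h3⟩ := (h.inv t).exists_open_of_not_mem h.isTree hcon
    have := h1.2 u h2
    rw [ha.2] at this
    lia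
  refine ⟨h.open_of_open ht hdisc hv.1, fun u hu => ?_⟩
  rw [hv', ← ha.2]
  exact h1.2 u hu

/-- Every candidate accounts for `loadBefore s m t i` robots that are anchored at it and for one
more robot below it, whose anchor is less deep. -/
lemma card_candidates_mul_le [Fintype V] [DecidablePred (· ∈ (s t).candidates T root)] :
    (Finset.univ.filter (· ∈ (s t).candidates T root)).card * (loadBefore s m t i + 1) ≤ k := by
  classical
  set B : V → Finset (Fin k) := fun v => Finset.univ.filter fun r =>
    (m t i.castSucc).anchor r = v ∨
      (Anc T root v ((s t).pos r) ∧ T.dist root ((m t i.castSucc).anchor r) < d) with hB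
  have hcard : ∀ v ∈ Finset.univ.filter (· ∈ (s t).candidates T root),
      loadBefore s m t i + 1 ≤ (B v).card := by
    intro v hv
    replace hv := (Finset.mem_filter.1 hv).2
    refine (Nat.succ_le_succ (h.loadBefore_le hd ha hv)).trans (Finset.card_lt_card ?_)
    have hr := h.candidate_ne_root hd ha hv
    obtain ⟨g, -, hg2, hg3⟩ := (h.inv t).guard v hv.1 hr
    have hgp : (s t).pos g ≠ root := fun hp => hr ((hp ▸ hg2 : Anc T root v root).eq_root)
    have hga : (m t i.castSucc).anchor g = (s t).anchor g := by
      rw [(h.trace t).anchor_eq, (h.step t).anchor_same g hgp, ite_self]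
    rw [Finset.ssubset_iff_of_subset fun r hr => by
      simp only [Finset.mem_filter, Finset.mem_univ, true_and, hB] at hr ⊢
      exact .inl hr]
    refine ⟨g, ?_, ?_⟩
    · simp only [Finset.mem_filter, Finset.mem_univ, true_and, hB, hga]
      rw [h.dist_candidate hd ha hv] at hg3
      exact .inr ⟨hg2, hg3⟩
    · simp only [Finset.mem_filter, Finset.mem_univ, true_and, hga]
      rintro rfl
      exact lt_irrefl _ hg3
  have hdisj : (↑(Finset.univ.filter (· ∈ (s t).candidates T root)) : Set V).PairwiseDisjoint B := by
    intro v hv w hw hne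
    replace hv := h.dist_candidate hd ha (Finset.mem_filter.1 hv).2
    replace hw := h.dist_candidate hd ha (Finset.mem_filter.1 hw).2
    refine Finset.disjoint_left.2 fun r h1 h2 => ?_
    simp only [Finset.mem_filter, Finset.mem_univ, true_and, hB] at h1 h2
    rcases h1 with rfl | ⟨h1, h1'⟩ <;> rcases h2 with rfl | ⟨h2, h2'⟩
    · exact hne rfl
    · lia
    · lia
    · exact hne (h1.eq_of_dist_eq h.isTree h2 (hv.trans hw.symm))
  calc _ ≤ ∑ v ∈ Finset.univ.filter (· ∈ (s t).candidates T root), (B v).card :=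
        Finset.card_nsmul_le_sum _ _ _ hcard
    _ = _ := (Finset.card_biUnion hdisj).symm
    _ ≤ k := by simpa using Finset.card_le_univ (Finset.biUnion _ B)

lemma loadBefore_lt [Fintype V] : loadBefore s m t i < k := by
  classical
  have h1 := h.card_candidates_mul_le hd ha
  have h2 : 0 < (Finset.univ.filter (· ∈ (s t).candidates T root)).card :=
    Finset.card_pos.2 ⟨_, Finset.mem_filter.2 ⟨Finset.mem_univ _, h.assigned_mem hd ha⟩⟩
  nlinarith

/-- Loads of candidates only grow, so two assignments of the same anchor see different loads. -/
lemma loadBefore_lt_loadBefore {t' : ℕ} {i' : Fin k} (ha' : Assigned T root s d t' i')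
    (hlt : t < t' ∨ (t = t' ∧ i < i'))
    (heq : (s (t + 1)).anchor i = (s (t' + 1)).anchor i') :
    loadBefore s m t i < loadBefore s m t' i' := by
  have hr := ha.ne_root hd
  have hop := (h.assigned_mem hd ha).1
  have hop' := (h.assigned_mem hd ha').1
  rw [loadBefore, loadBefore, ← heq]
  rw [← heq] at hop'
  have hlate : t < t' → ∀ r, (s (t + 1)).anchor r = (s (t + 1)).anchor i →
      (m t' i'.castSucc).anchor r = (s (t + 1)).anchor i := fun hlt r h1 =>
    h.mid_of_anchor hr hop' (h.anchor_of_le hlt hr hop' h1)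
  refine Finset.card_lt_card ((Finset.ssubset_iff_of_subset fun r h1 => ?_).2 ⟨i, ?_, ?_⟩)
  · simp only [Finset.mem_filter, Finset.mem_univ, true_and] at h1 ⊢
    rcases hlt with hlt | ⟨rfl, hlt⟩
    · exact hlate hlt r (h.anchor_succ_of_mid hr hop h1)
    · have h2 := h.anchor_succ_of_mid hr hop h1
      rw [(h.trace t).anchor_eq] at h1 ⊢
      split_ifs with h3
      · exact h2
      · rw [if_neg] at h1
        · exact h1
        · simp only [Fin.castSucc_lt_castSucc_iff] at h3 ⊢
          lia
  · simp only [Finset.mem_filter, Finset.mem_univ, true_and]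
    rcases hlt with hlt | ⟨rfl, hlt⟩
    · exact hlate hlt i rfl
    · rw [(h.trace t).anchor_eq, if_pos (by simpa using hlt)]
  · simp only [Finset.mem_filter, Finset.mem_univ, true_and]
    rw [(h.trace t).anchor_eq, if_neg (lt_irrefl _)]
    exact fun h1 => h.pos_ne_root hr hop h1 ha.1

end Assigned

/-! ### Robots that have reached a crowded anchor -/

/-- A dangling edge is traversed by a single robot, and once. -/
lemma traversal_injective {t t' : ℕ} {i i' : Fin k}
    (hi : s((s t).pos i, (s (t + 1)).pos i) ∈ (s t).dangling T)
    (hi' : s((s t').pos i', (s (t' + 1)).pos i') ∈ (s t').dangling T)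
    (heq : s((s t).pos i, (s (t + 1)).pos i) = s((s t').pos i', (s (t' + 1)).pos i')) :
    t = t' ∧ i = i' := by
  have hexp : ∀ t i, s((s t).pos i, (s (t + 1)).pos i) ∈ (s t).dangling T →
      s((s t).pos i, (s (t + 1)).pos i) ∈ (s (t + 1)).explored := by
    intro t i hi
    exact (h.step t).edge_explored (SimpleGraph.mem_edgeSet T |>.1 hi.1).ne'
  rcases lt_trichotomy t t' with hlt | rfl | hlt
  · exact absurd (heq ▸ h.explored_mono hlt (hexp t i hi)) hi'.2.2
  · exact ⟨rfl, (h.step t).injective i i' hi heq⟩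
  · exact absurd (heq.symm ▸ h.explored_mono hlt (hexp t' i' hi')) hi.2.2

lemma length_stack_succ {t : ℕ} {i : Fin k} (hp : (s t).pos i ≠ root) :
    ((s (t + 1)).stack i).length ≤ ((s t).stack i).length - 1 := by
  cases (h.step t).outcome i with
  | follow hs hc hd hm => simp [hs hp]
  | discover hs hr hs' hc he => simp [hs']
  | back hp hs hs' hp' hcl => simp [hs']
  | stay hp hp' hs' hr hcl => simp [hs']

lemma exists_arrival {t : ℕ} {r : Fin k} {v : V} (hv : v ≠ root) (hop : v ∈ (s t).openNodes T)
    (hr : (s t).anchor r = v) (hs : (s t).stack r = []) :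
    ∃ t' ≤ t, (s t').pos r = v ∧ (s t').stack r = [] := by
  induction t with
  | zero =>
    rw [h.zero] at hr
    exact absurd hr.symm hv
  | succ t ih =>
    have hback : (s t).pos r ≠ root → (s t).stack r = [] →
        ∃ t' ≤ t + 1, (s t').pos r = v ∧ (s t').stack r = [] := by
      intro hp hs
      have hr' := (h.step t).anchor_same r hp ▸ hr
      have hd : v ∈ (s t).discovered := hr' ▸ (h.inv t).anchor_mem r
      obtain ⟨t', h1, h2⟩ := ih ((h.step t).open_of_open hd hop) hr' hs
      exact ⟨t', by lia, h2⟩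
    cases (h.step t).outcome r with
    | follow _ hc hd hm =>
      rw [hs] at hd
      exact ⟨t + 1, le_rfl, hr ▸ hd, hs⟩
    | discover hs hr' hs' hc he =>
      by_cases hp : (s t).pos r = root
      · exact absurd (hr.symm.trans (hr' hp)) hv
      · exact hback hp (hs hp)
    | back hp hs hs' hp' hcl => exact hback hp hs
    | stay hp hp' hs' hr' hcl => exact absurd (hr.symm.trans hr') hv

/-- If a node stays open, every robot that has reached it as its anchor has then left it through a
dangling edge. -/
lemma exists_traversal {t t' : ℕ} (ht : t < t') {r : Fin k} {v : V} (hv : v ≠ root)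
    (hop : v ∈ (s t').openNodes T) (hr : (s t).anchor r = v) (hs : (s t).stack r = []) :
    ∃ t₀ ≤ t, (s t₀).pos r = v ∧
      s((s t₀).pos r, (s (t₀ + 1)).pos r) ∈ (s t₀).dangling T := by
  have hd : v ∈ (s t).discovered := hr ▸ (h.inv t).anchor_mem r
  obtain ⟨t₀, h1, h2, h3⟩ := h.exists_arrival hv (h.open_of_open ht.le hd hop) hr hs
  refine ⟨t₀, h1, h2, ?_⟩
  have hd₀ : v ∈ (s t₀).discovered := h2 ▸ (h.inv t₀).pos_mem r
  have hop₀ := h.open_of_open (show t₀ + 1 ≤ t' by lia)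
    ((h.step t₀).discovered_mono hd₀) hop
  cases (h.step t₀).outcome r with
  | follow hs hc hd hm =>
    have := hs (h2 ▸ hv)
    simp [h3] at this
  | discover hs hr' hs' hc he => exact he
  | back hp hs hs' hp' hcl => exact absurd hop₀ ((h.step t₀).not_open hd₀ (h2 ▸ hcl))
  | stay hp hp' hs' hr' hcl => exact absurd (h2.symm.trans hp) hv

/-- Fewer robots than its degree have reached their anchor if the anchor is still open. -/
lemma card_lt_degree [Fintype V] [DecidableRel T.Adj] {t t' : ℕ} (ht : t < t') {v : V}
    (hv : v ≠ root) (hop : v ∈ (s t').openNodes T) {A : Finset (Fin k)}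
    (hA : ∀ r ∈ A, (s t).anchor r = v ∧ (s t).stack r = []) : A.card < T.degree v := by
  have hex : ∀ r, ∃ t₀, r ∈ A → t₀ ≤ t ∧ (s t₀).pos r = v ∧
      s((s t₀).pos r, (s (t₀ + 1)).pos r) ∈ (s t₀).dangling T := by
    intro r
    by_cases hr : r ∈ A
    · obtain ⟨t₀, h1, h2⟩ := h.exists_traversal ht hv hop (hA r hr).1 (hA r hr).2
      exact ⟨t₀, fun _ => ⟨h1, h2⟩⟩
    · exact ⟨0, fun hr' => absurd hr' hr⟩
  choose τ hτ using hex
  obtain ⟨-, e, he, w, rfl⟩ := hop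
  rw [← SimpleGraph.card_neighborFinset_eq_degree]
  refine lt_of_le_of_lt (Finset.card_le_card_of_injOn (t := (T.neighborFinset v).erase w)
    (fun r => (s (τ r + 1)).pos r) (fun r hr => ?_) fun r hr r' hr' heq => ?_)
    (Finset.card_erase_lt_of_mem ?_)
  · obtain ⟨h1, h2, h3⟩ := hτ r hr
    rw [h2] at h3
    refine Finset.mem_erase.2 ⟨fun h4 => ?_, (T.mem_neighborFinset _ _).2 h3.1⟩
    have h5 := (h.step (τ r)).edge_explored (i := r) (by
      rw [h2]
      exact (SimpleGraph.mem_edgeSet T |>.1 h3.1).ne')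
    rw [h2, show (s (τ r + 1)).pos r = w from h4] at h5
    exact he.2.2 (h.explored_mono (show τ r + 1 ≤ t' by lia) h5)
  · obtain ⟨-, h2, h3⟩ := hτ r hr
    obtain ⟨-, h2', h3'⟩ := hτ r' hr'
    refine (h.traversal_injective h3 h3' ?_).2
    rw [h2, h2']
    exact congrArg _ heq
  · exact (T.mem_neighborFinset _ _).2 he.1

/-- After receiving an anchor of depth `d`, a robot goes down for `d` rounds. -/
lemma dist_pos_of_assigned {d t : ℕ} {i : Fin k} (hd : 1 ≤ d) (ha : Assigned T root s d t i)
    {x : ℕ} (hx : x < d) :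
    T.dist root ((s (t + 1 + x)).pos i) = x + 1 ∧
      ((s (t + 1 + x)).stack i).length + x + 1 = d := by
  have hne := ha.ne_root hd
  induction x with
  | zero =>
    cases (h.step t).outcome i with
    | follow _ hc hdesc hm =>
      have h1 := hc.dist h.isTree
      have h2 := hdesc.dist h.isTree
      rw [ha.1, SimpleGraph.dist_self] at h1
      rw [ha.2] at h2
      simp only [add_zero]
      lia
    | discover hs hr hs' hc he => exact absurd (hr ha.1) hne
    | back hp _ _ _ _ => exact absurd ha.1 hp
    | stay _ _ _ hr _ => exact absurd hr hne
  | succ x ih =>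
    obtain ⟨h1, h2⟩ := ih (by lia)
    have hp : (s (t + 1 + x)).pos i ≠ root := by
      intro hp
      simp [hp] at h1
    have hs : (s (t + 1 + x)).stack i ≠ [] := by
      intro hs
      rw [hs, List.length_nil] at h2
      lia
    rw [← add_assoc]
    cases (h.step (t + 1 + x)).outcome i with
    | follow hs' hc hdesc hm =>
      rw [hs' hp, List.length_cons] at h2
      have := hc.dist h.isTree
      lia
    | discover hs' _ _ _ _ => exact absurd (hs' hp) hs
    | back _ hs' _ _ _ => exact absurd hs' hs
    | stay hp' _ _ _ _ => exact absurd hp' hp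

/-- At most once does a robot receive an anchor of depth `d` whose load is at least the maximum
degree. Indeed, by the time the robot receives its next anchor of this depth, all robots that were
anchored at a candidate at the time of the first one have reached it, and left it through distinct
edges. -/
lemma loadBefore_lt_maxDegree [Fintype V] [DecidableRel T.Adj] {d t t' : ℕ} {i : Fin k}
    (hd : 1 ≤ d) (ha : Assigned T root s d t i) (ha' : Assigned T root s d t' i) (hlt : t < t') :
    loadBefore s m t i < T.maxDegree := by
  have hlong : t + d < t' := by
    by_contra hcon
    obtain ⟨x, rfl⟩ : ∃ x, t' = t + 1 + x := ⟨t' - (t + 1), by lia⟩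
    have := (h.dist_pos_of_assigned hd ha (x := x) (by lia)).1
    simp [ha'.1] at this
  set v := (s (t' + 1)).anchor i with hvdef
  have hv : v ≠ root := ha'.ne_root hd
  have hmem' := h.assigned_mem hd ha'
  have hmem := h.candidates_subset hd ha hlt.le ha' hmem'
  refine (h.loadBefore_le hd ha hmem).trans_lt
    (lt_of_lt_of_le ?_ (T.degree_le_maxDegree v))
  refine h.card_lt_degree hlong hv hmem'.1 fun r hr => ?_
  have hr1 := h.anchor_succ_of_mid hv hmem.1 (Finset.mem_filter.1 hr).2
  have hopen : ∀ y, t + 1 ≤ y → y ≤ t' → v ∈ (s y).openNodes T := fun y hy hy' =>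
    h.open_of_open hy' (h.discovered_mono (show t ≤ y by lia) hmem.1.1) hmem'.1
  have hanc : ∀ y, t + 1 ≤ y → y ≤ t' → (s y).anchor r = v := fun y hy hy' =>
    h.anchor_of_le hy hv (hopen y hy hy') hr1
  have hlen : ∀ x < d, ((s (t + 1 + x)).stack r).length ≤ d - 1 - x := by
    intro x
    induction x with
    | zero =>
      intro _
      by_cases hs : (s (t + 1)).stack r = []
      · simp [hs]
      · have h1 := ((h.inv (t + 1)).stack_descends r hs).dist h.isTree
        have h2 : (s (t + 1)).pos r ≠ root := fun hp => hs ((h.inv (t + 1)).stack_root r hp)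
        have h3 := (dist_eq_zero_iff_root (root := root) h.isTree).not.2 h2
        rw [hr1, ha'.2] at h1
        simp only [add_zero]
        lia
    | succ x ih =>
      intro hx
      have h1 := ih (by lia)
      have h2 := h.length_stack_succ (h.pos_ne_root hv (hopen (t + 1 + x) (by lia) (by lia))
        (hanc (t + 1 + x) (by lia) (by lia)))
      rw [← add_assoc]
      lia
  refine ⟨hanc (t + d) (by lia) hlong.le, List.eq_nil_of_length_eq_zero ?_⟩
  have := hlen (d - 1) (by lia)
  rw [show t + 1 + (d - 1) = t + d by lia] at this
  lia

end TracedRun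
end Runs

/-! ### The number of assignments of anchors of a given depth -/

section Counting
variable {V : Type*} {k : ℕ} {T : SimpleGraph V}
  {root : V} {s : ℕ → State V k}

open Classical in
/-- The assignments of anchors of depth `d` in the first `n` rounds. -/
noncomputable def assignments (T : SimpleGraph V) (root : V) (s : ℕ → State V k) (d n : ℕ) :
    Finset (ℕ × Fin k) :=
  (Finset.range n ×ˢ Finset.univ).filter fun x => Assigned T root s d x.1 x.2

lemma mem_assignments {d n : ℕ} {x : ℕ × Fin k} :
    x ∈ assignments T root s d n ↔ x.1 < n ∧ Assigned T root s d x.1 x.2 := by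
  simp [assignments]

variable [DecidableEq V]

namespace TracedRun
variable {m : ℕ → Fin (k + 1) → Memory V k} (h : TracedRun T root s m)
include h

lemma card_filter_loadBefore_eq_mul_le [Fintype V] {d : ℕ} (hd : 1 ≤ d) (n j : ℕ) :
    ((assignments T root s d n).filter fun x => loadBefore s m x.1 x.2 = j).card * (j + 1) ≤ k := by
  classical
  set E := (assignments T root s d n).filter fun x => loadBefore s m x.1 x.2 = j with hE
  have hmem : ∀ x ∈ E, Assigned T root s d x.1 x.2 ∧ loadBefore s m x.1 x.2 = j := by
    intro x hx
    rw [hE, Finset.mem_filter, mem_assignments] at hx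
    exact ⟨hx.1.2, hx.2⟩
  rcases E.eq_empty_or_nonempty with h0 | h0
  · simp [h0]
  -- All these assignments are of distinct nodes that were candidates at the first of them.
  obtain ⟨x₀, hx₀, hmin⟩ := Finset.exists_min_image E Prod.fst h0
  obtain ⟨ha₀, hj₀⟩ := hmem x₀ hx₀
  have hcard := h.card_candidates_mul_le hd ha₀
  rw [hj₀] at hcard
  refine (Nat.mul_le_mul_right _ ?_).trans hcard
  refine Finset.card_le_card_of_injOn (fun x => (s (x.1 + 1)).anchor x.2) (fun x hx => ?_)
    fun x hx y hy hxy => ?_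
  · obtain ⟨ha, -⟩ := hmem x hx
    exact Finset.mem_coe.2 (Finset.mem_filter.2 ⟨Finset.mem_univ _,
      h.candidates_subset hd ha₀ (hmin x hx) ha (h.assigned_mem hd ha)⟩)
  · obtain ⟨ha, hj⟩ := hmem x hx
    obtain ⟨ha', hj'⟩ := hmem y hy
    have hlt := fun hlt => h.loadBefore_lt_loadBefore hd ha ha' hlt hxy
    have hgt := fun hlt => h.loadBefore_lt_loadBefore hd ha' ha hlt hxy.symm
    rw [hj, hj'] at hlt hgt
    refine Prod.ext ?_ ?_
    · by_contra hne
      rcases Nat.lt_or_gt_of_ne hne with h1 | h1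
      · exact lt_irrefl _ (hlt (.inl h1))
      · exact lt_irrefl _ (hgt (.inl h1))
    · by_contra hne
      rcases lt_trichotomy x.1 y.1 with h1 | h1 | h1
      · exact lt_irrefl _ (hlt (.inl h1))
      · rcases lt_or_gt_of_ne hne with h2 | h2
        · exact lt_irrefl _ (hlt (.inr ⟨h1, h2⟩))
        · exact lt_irrefl _ (hgt (.inr ⟨h1.symm, h2⟩))
      · exact lt_irrefl _ (hgt (.inl h1))

/-- If a robot receives at most once an anchor of depth `d` with a load of at least `c`, then there
are at most `k * (log c + 2)` assignments of anchors of depth `d`: at most `k / (j + 1)` with load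
`j`, for each `j < c`, and at most `k` others. -/
lemma card_assignments_le [Fintype V] {d : ℕ} (hd : 1 ≤ d) (n c : ℕ)
    (hc : ∀ t t' i, Assigned T root s d t i → Assigned T root s d t' i → t < t' →
      loadBefore s m t i < c) :
    ((assignments T root s d n).card : ℝ) ≤ k * (Real.log c + 2) := by
  classical
  have hsplit := Finset.card_filter_add_card_filter_not
    (s := assignments T root s d n) (fun x => loadBefore s m x.1 x.2 < c)
  have hlate : ((assignments T root s d n).filter
      fun x => ¬ loadBefore s m x.1 x.2 < c).card ≤ k := by
    have := Finset.card_le_card_of_injOn (s := (assignments T root s d n).filter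
      fun x => ¬ loadBefore s m x.1 x.2 < c) (t := Finset.univ) Prod.snd (by simp)
      (fun x hx y hy hxy => by
        simp only [Finset.coe_filter, Set.mem_ofPred_eq, mem_assignments] at hx hy
        refine Prod.ext ?_ hxy
        rcases lt_trichotomy x.1 y.1 with h1 | h1 | h1
        · exact absurd (hc x.1 y.1 x.2 hx.1.2 (hxy ▸ hy.1.2) h1) hx.2
        · exact h1
        · exact absurd (hc y.1 x.1 y.2 hy.1.2 (hxy ▸ hx.1.2) h1) hy.2)
    simpa using this
  have hearly : ((((assignments T root s d n).filter
      fun x => loadBefore s m x.1 x.2 < c).card : ℕ) : ℝ) ≤ k * (1 + Real.log c) := by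
    rw [Finset.card_eq_sum_card_fiberwise (f := fun x => loadBefore s m x.1 x.2)
      (t := Finset.range c) (fun x hx => by simpa using (Finset.mem_filter.1 hx).2)]
    push_cast
    calc _ ≤ ∑ j ∈ Finset.range c, (k : ℝ) * ((j : ℝ) + 1)⁻¹ := by
          refine Finset.sum_le_sum fun j _ => ?_
          rw [← div_eq_mul_inv, le_div_iff₀ (by positivity)]
          refine le_trans ?_ (Nat.cast_le.2 (h.card_filter_loadBefore_eq_mul_le hd n j))
          push_cast
          gcongr
          exact Finset.filter_subset _ _
      _ = k * (harmonic c : ℝ) := by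
          rw [← Finset.mul_sum, harmonic]
          push_cast
          rfl
      _ ≤ _ := by gcongr; exact harmonic_le_one_add_log c
  have hlate' : ((((assignments T root s d n).filter
      fun x => ¬ loadBefore s m x.1 x.2 < c).card : ℕ) : ℝ) ≤ k := by exact_mod_cast hlate
  rw [← hsplit]
  push_cast
  linarith

lemma card_assignments_le_min [Fintype V] [DecidableRel T.Adj] {d : ℕ} (hd : 1 ≤ d) (n : ℕ) :
    ((assignments T root s d n).card : ℝ) ≤
      k * (min (Real.log T.maxDegree) (Real.log k) + 2) := by
  rcases min_choice (Real.log T.maxDegree) (Real.log k) with h1 | h1 <;> rw [h1]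
  · exact h.card_assignments_le hd n _ fun t t' i ha ha' hlt =>
      h.loadBefore_lt_maxDegree hd ha ha' hlt
  · exact h.card_assignments_le hd n _ fun t t' i ha _ _ => h.loadBefore_lt hd ha

/-! ### The running time -/

lemma dist_add_length_stack_le [Fintype V] (t : ℕ) (i : Fin k) :
    T.dist root ((s t).pos i) + ((s t).stack i).length ≤ depth T root := by
  have hle : ∀ v, T.dist root v ≤ depth T root := fun v =>
    Finset.le_sup (f := fun v => T.dist root v) (Finset.mem_univ v)
  by_cases hs : (s t).stack i = []
  · simpa [hs] using hle _
  · rw [← ((h.inv t).stack_descends i hs).dist h.isTree]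
    exact hle _

/-- An open node has an undiscovered child, so it is not of maximal depth. -/
lemma dist_lt_depth [Fintype V] {t : ℕ} {v : V} (hv : v ∈ (s t).openNodes T) :
    T.dist root v < depth T root := by
  obtain ⟨hd, e, he, w, rfl⟩ := hv
  have hc := ((h.inv t).isChild_of_dangling h.isTree hd he).dist h.isTree
  have : T.dist root w ≤ depth T root :=
    Finset.le_sup (f := fun v => T.dist root v) (Finset.mem_univ w)
  lia

end TracedRun

/-- The number of moves that robot `i` still has to make in state `s` if it makes no further
discoveries and receives no further anchor: along its stack, and then back to the root. -/
noncomputable def remaining (T : SimpleGraph V) (root : V) (s : State V k) (i : Fin k) : ℕ :=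
  T.dist root (s.pos i) + 2 * (s.stack i).length

open Classical in
/-- The pairs of a round among the first `n` and a robot that traverses a dangling edge in it. -/
noncomputable def discoveries (T : SimpleGraph V) (s : ℕ → State V k) (n : ℕ) :
    Finset (ℕ × Fin k) :=
  (Finset.range n ×ˢ Finset.univ).filter fun x =>
    s((s x.1).pos x.2, (s (x.1 + 1)).pos x.2) ∈ (s x.1).dangling T

open Classical in
/-- The pairs of a round among the first `n` and a robot that stays at the root in it. -/
noncomputable def pauses (root : V) (s : ℕ → State V k) (n : ℕ) : Finset (ℕ × Fin k) :=
  (Finset.range n ×ˢ Finset.univ).filter fun x =>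
    (s x.1).pos x.2 = root ∧ (s (x.1 + 1)).pos x.2 = root

/-- The depth of the anchor that robot `i` receives in round `t`, or `0` if it receives none. -/
noncomputable def assignedDepth (T : SimpleGraph V) (root : V) (s : ℕ → State V k) (t : ℕ)
    (i : Fin k) : ℕ :=
  if (s t).pos i = root then T.dist root ((s (t + 1)).anchor i) else 0

namespace TracedRun
variable {m : ℕ → Fin (k + 1) → Memory V k} (h : TracedRun T root s m)
include h

/-- In every round a robot pauses, or it makes a move that is paid for by a move that remained, by a
discovery (a move down and a move back up), or by a new anchor (as many moves down and up as the
anchor is deep). -/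
lemma remaining_succ (t : ℕ) (i : Fin k) [Decidable (s((s t).pos i, (s (t + 1)).pos i) ∈
    (s t).dangling T)] :
    1 + remaining T root (s (t + 1)) i ≤ remaining T root (s t) i +
      2 * (if s((s t).pos i, (s (t + 1)).pos i) ∈ (s t).dangling T then 1 else 0) +
      (if (s t).pos i = root ∧ (s (t + 1)).pos i = root then 1 else 0) +
      2 * assignedDepth T root s t i := by
  unfold remaining assignedDepth
  cases (h.step t).outcome i with
  | follow hs hc hd hm =>
    have h1 := hc.dist h.isTree
    by_cases hp : (s t).pos i = root
    · have h2 := hd.dist h.isTree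
      rw [hp, SimpleGraph.dist_self] at h1
      rw [if_pos hp]
      lia
    · have h2 : ((s t).stack i).length = ((s (t + 1)).stack i).length + 1 := by
        rw [hs hp, List.length_cons]
      lia
  | discover hs hr hs' hc he =>
    have h1 := hc.dist h.isTree
    rw [if_pos he, hs', List.length_nil]
    lia
  | back hp hs hs' hp' hcl =>
    have h1 := dist_par h.isTree hp
    rw [← hp'] at h1
    rw [hs', List.length_nil]
    lia
  | stay hp hp' hs' hr hcl =>
    have h1 : T.dist root ((s (t + 1)).pos i) = 0 := by rw [hp', SimpleGraph.dist_self]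
    rw [if_pos (⟨hp, hp'⟩ : _ ∧ _), hs', List.length_nil]
    lia

lemma mul_add_sum_remaining_le (n : ℕ) :
    k * n + ∑ i, remaining T root (s n) i ≤ 2 * (discoveries T s n).card +
      (pauses root s n).card +
      2 * ∑ x ∈ Finset.range n ×ˢ Finset.univ, assignedDepth T root s x.1 x.2 := by
  classical
  have key : ∀ i, n + remaining T root (s n) i ≤ ∑ t ∈ Finset.range n,
      (2 * (if s((s t).pos i, (s (t + 1)).pos i) ∈ (s t).dangling T then 1 else 0) +
      (if (s t).pos i = root ∧ (s (t + 1)).pos i = root then 1 else 0) +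
      2 * assignedDepth T root s t i) := by
    intro i
    induction n with
    | zero => simp [remaining, h.zero, State.init]
    | succ n ih =>
      rw [Finset.sum_range_succ]
      have := h.remaining_succ n i
      lia
  have hsum := Finset.sum_le_sum fun i (_ : i ∈ Finset.univ) => key i
  rw [Finset.sum_add_distrib, Finset.sum_const, Finset.card_univ, Fintype.card_fin, smul_eq_mul,
    Finset.sum_comm, ← Finset.sum_product'] at hsum
  refine hsum.trans (le_of_eq ?_)
  rw [Finset.sum_add_distrib, Finset.sum_add_distrib, ← Finset.mul_sum, ← Finset.mul_sum,
    discoveries, pauses, Finset.card_filter, Finset.card_filter]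

lemma card_discoveries_lt [Fintype V] (n : ℕ) : (discoveries T s n).card < Fintype.card V := by
  classical
  rw [← h.isTree.card_edgeFinset, Nat.lt_succ_iff]
  refine Finset.card_le_card_of_injOn (fun x => s((s x.1).pos x.2, (s (x.1 + 1)).pos x.2))
    (fun x hx => ?_) fun x hx y hy hxy => ?_
  · exact Finset.mem_coe.2 (SimpleGraph.mem_edgeFinset.2 (Finset.mem_filter.1 hx).2.1)
  · obtain ⟨h1, h2⟩ :=
      h.traversal_injective (Finset.mem_filter.1 hx).2 (Finset.mem_filter.1 hy).2 hxy
    exact Prod.ext h1 h2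

/-- While there are dangling edges, a robot that stays at the root has the root as its anchor, and
all dangling edges at the root are traversed in this round. -/
lemma root_open_of_pause [Fintype V] {t : ℕ} {i : Fin k} (hd : (s t).dangling T ≠ ∅)
    (hp : (s t).pos i = root) (hp' : (s (t + 1)).pos i = root) :
    root ∈ (s t).openNodes T ∧ root ∉ (s (t + 1)).openNodes T := by
  cases (h.step t).outcome i with
  | follow hs hc hd hm => exact absurd hp' hc.1
  | discover hs hr hs' hc he => exact absurd hp' hc.1
  | back hp₁ _ _ _ _ => exact absurd hp hp₁
  | stay _ _ hs' hr hcl =>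
    refine ⟨?_, (h.step t).not_open (h.inv t).root_mem (hp ▸ hcl)⟩
    rcases (h.step t).anchor_root i hp with h1 | ⟨h1, -⟩
    · exact hr ▸ h1.1
    · exfalso
      obtain ⟨e, he⟩ := Set.nonempty_iff_ne_empty.2 hd
      obtain ⟨u, hu, hu'⟩ := he.2.1
      obtain ⟨v, hv, hmin⟩ := Set.exists_min_image ((s t).openNodes T) (fun v => T.dist root v)
        (Set.toFinite _) ⟨u, hu', e, he, hu⟩
      exact Set.eq_empty_iff_forall_notMem.1 h1 v ⟨hv, hmin⟩

/-- All pauses before the end of the exploration happen in the same round. -/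
lemma card_pauses_le [Fintype V] {n : ℕ} (hn : ∀ t < n, (s t).dangling T ≠ ∅) :
    (pauses root s n).card ≤ k := by
  classical
  have hmem : ∀ x ∈ pauses root s n,
      root ∈ (s x.1).openNodes T ∧ root ∉ (s (x.1 + 1)).openNodes T := by
    intro x hx
    simp only [pauses, Finset.mem_filter, Finset.mem_product, Finset.mem_range] at hx
    exact h.root_open_of_pause (hn _ hx.1.1) hx.2.1 hx.2.2
  have hnlt : ∀ x ∈ pauses root s n, ∀ y ∈ pauses root s n, ¬ x.1 < y.1 := fun x hx y hy hlt =>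
    (hmem x hx).2 (h.open_of_open hlt (h.inv _).root_mem (hmem y hy).1)
  have := Finset.card_le_card_of_injOn (t := Finset.univ) Prod.snd
    (fun x _ => Finset.mem_univ _) (fun x hx y hy hxy =>
      Prod.ext (le_antisymm (not_lt.1 (hnlt y hy x hx)) (not_lt.1 (hnlt x hx y hy))) hxy :
      Set.InjOn Prod.snd (pauses root s n : Set (ℕ × Fin k)))
  simpa using this

lemma sum_assignedDepth_le [Fintype V] [DecidableRel T.Adj] (n : ℕ) :
    2 * ((∑ x ∈ Finset.range n ×ˢ Finset.univ, assignedDepth T root s x.1 x.2 : ℕ) : ℝ) ≤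
      depth T root * (depth T root - 1) *
        (k * (min (Real.log T.maxDegree) (Real.log k) + 2)) := by
  classical
  set B := k * (min (Real.log T.maxDegree) (Real.log k) + 2) with hB
  set D := depth T root with hD
  rcases Nat.eq_zero_or_pos D with h0 | hpos
  · have : ∀ v, T.dist root v = 0 := fun v => Nat.le_zero.1 (h0 ▸ Finset.le_sup
      (f := fun v => T.dist root v) (Finset.mem_univ v))
    simp [assignedDepth, this, h0]
  have hmaps : ∀ x ∈ Finset.range n ×ˢ (Finset.univ : Finset (Fin k)),
      assignedDepth T root s x.1 x.2 ∈ Finset.range D := by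
    intro x _
    rw [Finset.mem_range, assignedDepth]
    split_ifs with hp
    · rcases (h.step x.1).anchor_root x.2 hp with h1 | ⟨-, h1⟩
      · exact h.dist_lt_depth h1.1
      · simpa [h1] using hpos
    · exact hpos
  have hfib : ∀ d ∈ Finset.range D, ((∑ x ∈ (Finset.range n ×ˢ Finset.univ).filter
      (fun x : ℕ × Fin k => assignedDepth T root s x.1 x.2 = d),
      assignedDepth T root s x.1 x.2 : ℕ) : ℝ) ≤ d * B := by
    intro d _
    rw [Finset.sum_congr rfl (g := fun _ => d) fun x hx => (Finset.mem_filter.1 hx).2,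
      Finset.sum_const, smul_eq_mul, mul_comm]
    push_cast
    rcases Nat.eq_zero_or_pos d with rfl | hd
    · simp
    gcongr
    refine le_trans (Nat.cast_le.2 (Finset.card_le_card fun x hx => ?_))
      (h.card_assignments_le_min hd n)
    rw [Finset.mem_filter, Finset.mem_product, Finset.mem_range] at hx
    rw [mem_assignments]
    refine ⟨hx.1.1, ?_⟩
    have h1 := hx.2
    rw [assignedDepth] at h1
    split_ifs at h1 with hp
    · exact ⟨hp, h1⟩
    · lia
  rw [← Finset.sum_fiberwise_of_maps_to hmaps]
  push_cast at hfib ⊢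
  have hgauss : (∑ d ∈ Finset.range D, (d : ℝ)) * 2 = D * (D - 1) := by
    have := congrArg (Nat.cast : ℕ → ℝ) (Finset.sum_range_id_mul_two D)
    push_cast [Nat.cast_sub hpos] at this
    exact this
  calc _ ≤ 2 * ∑ d ∈ Finset.range D, (d : ℝ) * B := by
        gcongr with d hd
        exact hfib d hd
    _ = ((∑ d ∈ Finset.range D, (d : ℝ)) * 2) * B := by rw [← Finset.sum_mul]; ring
    _ = _ := by rw [hgauss]

/-- A bound on the number `n` of rounds that start with a dangling edge. -/
lemma mul_le_of_dangling [Fintype V] [DecidableRel T.Adj] {n : ℕ}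
    (hn : ∀ t < n, (s t).dangling T ≠ ∅) :
    (k : ℝ) * n ≤ 2 * Fintype.card V + k + depth T root * (depth T root - 1) *
        (k * (min (Real.log T.maxDegree) (Real.log k) + 2)) := by
  have h1 := (Nat.le_add_right _ _).trans (h.mul_add_sum_remaining_le n)
  have h2 := h.card_discoveries_lt n
  have h3 := h.card_pauses_le hn
  have h4 := h.sum_assignedDepth_le n
  have h5 : k * n ≤ 2 * Fintype.card V + k +
      2 * ∑ x ∈ Finset.range n ×ˢ Finset.univ, assignedDepth T root s x.1 x.2 := by lia
  have h6 : ((k * n : ℕ) : ℝ) ≤ ((2 * Fintype.card V + k +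
      2 * ∑ x ∈ Finset.range n ×ˢ Finset.univ, assignedDepth T root s x.1 x.2 : ℕ) : ℝ) :=
    Nat.cast_le.2 h5
  rw [Nat.cast_mul, Nat.cast_add, Nat.cast_mul 2 (∑ x ∈ _, _)] at h6
  push_cast at h6 h4
  linarith

lemma exists_dangling_eq_empty [Fintype V] [DecidableRel T.Adj] (hk : 1 ≤ k) :
    ∃ n, (s n).dangling T = ∅ := by
  by_contra! hcon
  set C := 2 * (Fintype.card V : ℝ) + k + depth T root * (depth T root - 1) *
        (k * (min (Real.log T.maxDegree) (Real.log k) + 2))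
  obtain ⟨n, hn⟩ := exists_nat_gt C
  have h1 := h.mul_le_of_dangling (n := n) fun t _ => Set.nonempty_iff_ne_empty.1 (hcon t)
  have h2 : (1 : ℝ) ≤ k := by exact_mod_cast hk
  have h3 : (0 : ℝ) ≤ n := n.cast_nonneg
  nlinarith

/-! ### After the exploration -/

lemma remaining_succ_of_dangling {t : ℕ} (hd : (s t).dangling T = ∅) (i : Fin k) :
    remaining T root (s (t + 1)) i ≤ remaining T root (s t) i - 1 := by
  classical
  have hcan : (s t).pos i = root → (s (t + 1)).anchor i = root := by
    intro hp
    rcases (h.step t).anchor_root i hp with h1 | ⟨-, h1⟩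
    · obtain ⟨-, e, he, -⟩ := h1.1
      simp [hd] at he
    · exact h1
  have h1 := h.remaining_succ t i
  rw [if_neg (by simp [hd])] at h1
  have h2 : assignedDepth T root s t i = 0 := by
    rw [assignedDepth]
    split_ifs with hp
    · simp [hcan hp]
    · rfl
  rw [h2] at h1
  split_ifs at h1 with hp
  · have h3 : remaining T root (s (t + 1)) i = 0 := by
      simp [remaining, hp.2, (h.inv (t + 1)).stack_root i hp.2]
    lia
  · lia

lemma remaining_le [Fintype V] (t : ℕ) (i : Fin k) :
    remaining T root (s t) i ≤ 2 * depth T root - 1 := by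
  have h1 := h.dist_add_length_stack_le t i
  unfold remaining
  by_cases hp : (s t).pos i = root
  · simp [hp, (h.inv t).stack_root i hp]
  · have := (dist_eq_zero_iff_root (root := root) h.isTree).not.2 hp
    lia

lemma dangling_eq_empty_of_le {t t' : ℕ} (ht : t ≤ t') (hd : (s t).dangling T = ∅) :
    (s t').dangling T = ∅ :=
  by_contra fun hcon => h.dangling_ne_empty ht hcon hd

lemma pos_eq_root [Fintype V] {t : ℕ} (hd : (s t).dangling T = ∅) (i : Fin k) :
    (s (t + (2 * depth T root - 1))).pos i = root := by
  have key : ∀ x, remaining T root (s (t + x)) i ≤ 2 * depth T root - 1 - x := by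
    intro x
    induction x with
    | zero => exact h.remaining_le t i
    | succ x ih =>
      have := h.remaining_succ_of_dangling (h.dangling_eq_empty_of_le (Nat.le_add_right t x) hd) i
      rw [← add_assoc]
      lia
  have h1 := key (2 * depth T root - 1)
  rw [remaining] at h1
  rw [← dist_eq_zero_iff_root (root := root) h.isTree]
  lia

lemma pos_succ_ne {t : ℕ} {i : Fin k} (hp : (s t).pos i ≠ root) :
    (s (t + 1)).pos i ≠ (s t).pos i := by
  cases (h.step t).outcome i with
  | follow hs hc hd hm => exact (hc.adj h.isTree).ne'
  | discover hs hr hs' hc he => exact (hc.adj h.isTree).ne'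
  | back hp hs hs' hp' hcl => exact hp' ▸ (adj_par h.isTree hp).ne'
  | stay hp' _ _ _ _ => exact absurd hp' hp

/-- Some robot moves as long as there is a dangling edge: if all stay at the root, then no dangling
edge is traversed although the root is open, whereas a robot stays only if all dangling edges at the
root are traversed. -/
lemma pos_succ_ne_of_dangling [Fintype V] {t : ℕ} (hk : 1 ≤ k) (hd : (s t).dangling T ≠ ∅) :
    (s (t + 1)).pos ≠ (s t).pos := by
  intro heq
  have hroot : ∀ i, (s t).pos i = root := fun i =>
    by_contra fun hp => h.pos_succ_ne hp (congrFun heq i)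
  have i₀ : Fin k := ⟨0, hk⟩
  obtain ⟨⟨h1, e, he, hre⟩, h2⟩ := h.root_open_of_pause hd (hroot i₀)
    (congrFun heq i₀ ▸ hroot i₀)
  refine h2 ⟨(h.step t).discovered_mono h1, e,
    ⟨he.1, ⟨root, hre, (h.step t).discovered_mono h1⟩, fun hexp => ?_⟩, hre⟩
  rcases ((h.step t).explored_iff e).1 hexp with h3 | ⟨i, h3, -⟩
  · exact he.2.2 h3
  · exact h3 (congrFun heq i)

lemma pos_succ_eq {t : ℕ} (hd : (s t).dangling T = ∅) (hp : ∀ i, (s t).pos i = root) :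
    (s (t + 1)).pos = (s t).pos := by
  funext i
  have h1 := h.remaining_succ_of_dangling hd i
  have h2 : remaining T root (s t) i = 0 := by
    simp [remaining, hp i, (h.inv t).stack_root i (hp i)]
  rw [hp i, ← dist_eq_zero_iff_root (root := root) h.isTree]
  rw [remaining, h2] at h1
  lia

lemma exploredAndReturned {t : ℕ} (hd : (s t).dangling T = ∅)
    (hp : ∀ i, (s t).pos i = root) : ExploredAndReturned T root (s t) := by
  have hdisc : (s t).discovered = Set.univ := by
    refine Set.eq_univ_of_forall fun v => by_contra fun hv => ?_
    obtain ⟨u, ⟨-, e, he, -⟩, -⟩ := (h.inv t).exists_open_of_not_mem h.isTree hv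
    simp [hd] at he
  refine ⟨hd, hdisc, Set.Subset.antisymm (h.inv t).explored_sub fun e he => ?_, hp⟩
  by_contra hexp
  have : e ∈ (s t).dangling T := by
    induction e with
    | _ u v => exact ⟨he, ⟨u, by simp, hdisc ▸ Set.mem_univ u⟩, hexp⟩
  simp [hd] at this

end TracedRun
end Counting
end BFDN

theorem theorem1 {V : Type*} [Fintype V] [DecidableEq V] (T : SimpleGraph V)
    [DecidableRel T.Adj] (hT : T.IsTree) (root : V) (k : ℕ) (hk : 1 ≤ k) :
    (∃ s : ℕ → BFDN.State V k, BFDN.IsRun T root s) ∧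
    ∀ s : ℕ → BFDN.State V k, BFDN.IsRun T root s →
      ∃ R : ℕ, BFDN.StopsAfter s R ∧ BFDN.ExploredAndReturned T root (s R) ∧
        (∀ t < R, ¬ ((s t).dangling T = ∅ ∧ ∀ i, (s t).pos i = root)) ∧
        (R : ℝ) ≤ 2 * (Fintype.card V : ℝ) / (k : ℝ) +
          (BFDN.depth T root : ℝ) ^ 2 *
            (min (Real.log (T.maxDegree : ℝ)) (Real.log (k : ℝ)) + 2) := by
  classical
  refine ⟨BFDN.exists_run hT k, fun s hs => ?_⟩
  obtain ⟨m, h⟩ := hs.exists_tracedRun hT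
  have hex := h.exists_dangling_eq_empty hk
  set n := Nat.find hex with hn
  have hdn : (s n).dangling T = ∅ := Nat.find_spec hex
  have hlt : ∀ t < n, (s t).dangling T ≠ ∅ := fun t ht => Nat.find_min hex ht
  set D := BFDN.depth T root with hD
  have hexR : ∃ R, (s R).dangling T = ∅ ∧ ∀ i, (s R).pos i = root :=
    ⟨n + (2 * D - 1), h.dangling_eq_empty_of_le (Nat.le_add_right _ _) hdn,
      fun i => h.pos_eq_root hdn i⟩
  obtain ⟨hRd, hRp⟩ := Nat.find_spec hexR
  refine ⟨Nat.find hexR, ⟨fun t ht => ?_, h.pos_succ_eq hRd hRp⟩, h.exploredAndReturned hRd hRp,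
    fun t ht => Nat.find_min hexR ht, ?_⟩
  · by_cases hd : (s t).dangling T = ∅
    · have := Nat.find_min hexR ht
      push Not at this
      obtain ⟨i, hi⟩ := this hd
      exact fun heq => h.pos_succ_ne hi (congrFun heq i)
    · exact h.pos_succ_ne_of_dangling hk hd
  · have hR : Nat.find hexR ≤ n + (2 * D - 1) := Nat.find_min' hexR
      ⟨h.dangling_eq_empty_of_le (Nat.le_add_right _ _) hdn, fun i => h.pos_eq_root hdn i⟩
    have hk0 : (0 : ℝ) < k := by exact_mod_cast hk
    set L := min (Real.log (T.maxDegree : ℝ)) (Real.log (k : ℝ)) with hL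
    have hL0 : 0 ≤ L := le_min (Real.log_natCast_nonneg _) (Real.log_natCast_nonneg _)
    rcases Nat.eq_zero_or_pos D with h0 | hpos
    · -- A tree of depth `0` has no edge, so that the run stops at once.
      have hroot : ∀ v, v = root := fun v => (BFDN.dist_eq_zero_iff_root hT).1
        (Nat.le_zero.1 (h0 ▸ Finset.le_sup (f := fun v => T.dist root v) (Finset.mem_univ v)))
      have h1 : Nat.find hexR = 0 := by
        rw [Nat.find_eq_zero]
        refine ⟨Set.eq_empty_of_forall_notMem fun e he => ?_, fun i => hroot _⟩
        induction e with
        | _ u v => exact (SimpleGraph.mem_edgeSet T |>.1 he.1).ne ((hroot u).trans (hroot v).symm)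
      rw [h1, h0]
      push_cast
      positivity
    · have h1 := h.mul_le_of_dangling hlt
      rw [← hD, ← hL] at h1
      have h2 : (n : ℝ) ≤ 2 * Fintype.card V / k + 1 + D * (D - 1) * (L + 2) := by
        have h3 : 2 * (Fintype.card V : ℝ) / k * k = 2 * Fintype.card V :=
          div_mul_cancel₀ _ hk0.ne'
        refine le_of_mul_le_mul_left ?_ hk0
        linarith
      have h3 : (Nat.find hexR : ℝ) ≤ n + (2 * D - 1) := by
        have := Nat.cast_le (α := ℝ).2 hR
        rw [Nat.cast_add, Nat.cast_sub (by lia)] at this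
        push_cast at this
        exact this
      have hDL : 0 ≤ (D : ℝ) * L := by positivity
      nlinarith
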